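/- All spaces are Hausdorff and all maps are continuous. A space is $\omega$-bounded if each of its countable subsets has compact closure. A canonical cover of a space $X$ is a family $(X_\alpha)_{\alpha<\omega_1}$ of open subsets with union $X$ such that $\overline{X_\alpha}\subset X_\beta$ whenever $\alpha<\beta$, each $\overline{X_\alpha}$ is Lindelöf, $X_\alpha\neq X$ for every $\alpha$, and $X_\beta=\bigcup_{\alpha<\beta}X_\alpha$ for every limit ordinal $\beta<\omega_1$. A longpipe is an $\omega$-bounded space $X$ that has a canonical cover $(X_\alpha)_{\alpha<\omega_1}$ such that, for every $\alpha<\omega_1$, $X_{\alpha+1}$ is homeomorphic to $\mathbb{S}^1\times[0,1)$ and the topological boundary of $X_{\alpha+1}$ in $X_\beta$ is homeomorphic to $\mathbb{S}^1$ for each $\beta\ge\alpha+2$; it is a surface whose manifold boundary (the set of points without an open neighborhood homeomorphic to $\mathbb{R}^2$) is a circle. A sealed longpipe is a space obtained from a longpipe by gluing a closed disc to it along a homeomorphism between the bounding circle of the disc and the manifold boundary of the longpipe. For spaces $X,Y$, the property $\mathsf{EC}(X,Y)$ says that for each map $f:X\to Y$ there is a Lindelöf subset $Z\subset X$ such that $f(X-Z)$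 is a singleton, and $a\mathsf{S}(X,Y)$ says that for each map $f:X\to Y$ there are a Lindelöf subset $Z\subset X$ and a map $r:X\to Z$ such that $f\circ r=f$. **Theorem.** Let $X$ be either a longpipe or a sealed longpipe. If $\mathsf{EC}(X,\mathbb{R})$ holds, then $a\mathsf{S}(X,\mathbb{R})$ does not hold; that is, there is a map $f:X\to\mathbb{R}$ such that no map $r$ from $X$ into a Lindelöf subset of $X$ satisfies $f\circ r=f$. -/

import Mathlib

open scoped Ordinal

/-- `X` is eventually constant in `Y`: every continuous `f : X → Y` is constant outside of some
Lindelöf subset `Z`; more precisely `f (X - Z)` is a singleton. -/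
def EventuallyConstant (X Y : Type*) [TopologicalSpace X] [TopologicalSpace Y] : Prop :=
  ∀ f : C(X, Y), ∃ Z : Set X, IsLindelof Z ∧ ∃ y : Y, f '' Zᶜ = {y}

/-- `X` almost stagnates in `Y`: for every continuous `f : X → Y` there are a Lindelöf subset `Z`
of `X` and a continuous `r : X → Z` with `f ∘ r = f`. -/
def AlmostStagnates (X Y : Type*) [TopologicalSpace X] [TopologicalSpace Y] : Prop :=
  ∀ f : C(X, Y), ∃ Z : Set X, IsLindelof Z ∧ ∃ r : C(X, Z), ∀ x, f (r x) = f x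

/-- A space is `ω`-bounded if every countable subset has compact closure. -/
def OmegaBounded (X : Type*) [TopologicalSpace X] : Prop :=
  ∀ s : Set X, s.Countable → IsCompact (closure s)

/-- `S` (of which only the values `S α`, `α < ω₁`, matter) is a canonical Type I cover of `X`,
where the space `X` is required not to be exhausted at a countable stage. -/
structure IsCanonicalCover {X : Type*} [TopologicalSpace X] (S : Ordinal.{0} → Set X) : Prop where
  isOpen : ∀ α < ω₁, IsOpen (S α)
  closure_subset : ∀ α β, α < β → β < ω₁ → closure (S α) ⊆ S β
  isLindelof_closure : ∀ α < ω₁, IsLindelof (closure (S α))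
  exhausts : ∀ x : X, ∃ α < ω₁, x ∈ S α
  ne_univ : ∀ α < ω₁, S α ≠ Set.univ
  limit : ∀ β < ω₁, Order.IsSuccLimit β → S β = ⋃ α ∈ Set.Iio β, S α

/-- Longpipes: `ω`-bounded Hausdorff spaces with a canonical Type I cover `S` such that each
`S (α + 1)` is a half-open cylinder whose topological boundary is a circle.
These are surfaces with boundary: the open sets `S (α + 1)` are connected, increasing, and locally
homeomorphic to the plane or to the closed half-plane. Since `closure (S (α + 1))` is contained in
the open set `S β` for all `β ≥ α + 2`, the boundary of `S (α + 1)` in `S β` is the same set as the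
boundary of `S (α + 1)` in `X`. -/
def IsLongpipe (X : Type*) [TopologicalSpace X] : Prop :=
  T2Space X ∧ OmegaBounded X ∧ ∃ S : Ordinal.{0} → Set X, IsCanonicalCover S ∧
    (∀ α < ω₁, Nonempty (S (α + 1) ≃ₜ Circle × Set.Ico (0 : ℝ) 1)) ∧
    (∀ α < ω₁, Nonempty (frontier (S (α + 1)) ≃ₜ Circle))

/-- The manifold boundary of a surface with boundary: the points that have no open neighborhood
homeomorphic to the plane. -/
def surfaceBoundary (X : Type*) [TopologicalSpace X] : Set X :=
  {x | ¬ ∃ U : Set X, IsOpen U ∧ x ∈ U ∧ Nonempty (U ≃ₜ EuclideanSpace ℝ (Fin 2))}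

/-- Sealed longpipes: spaces obtained from a longpipe by sewing a closed disc along the manifold
boundary of the longpipe (a circle). That is, the Hausdorff space `X` contains an embedded closed
disc `e` whose interior `e (|z| < 1)` is open in `X`, the complement `P` of this interior is a
longpipe, and `e` maps the bounding circle of the disc onto the manifold boundary of `P`. As `P`
and the disc are closed, cover `X`, and meet exactly in that circle, `X` is the space glued from
`P` and the disc. -/
def IsSealedLongpipe (X : Type*) [TopologicalSpace X] : Prop :=
  T2Space X ∧ ∃ e : Metric.closedBall (0 : ℂ) 1 → X, Topology.IsEmbedding e ∧
    ∃ P : Set X, P = (e '' {z | ‖(z : ℂ)‖ < 1})ᶜ ∧ IsClosed P ∧ IsLongpipe P ∧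
      e '' {z | ‖(z : ℂ)‖ = 1} = Subtype.val '' surfaceBoundary P

/-!
Write `X` as a longpipe, or as a longpipe `P` sealed by a disc. A function `f : X → ℝ` is built
which is so rigid that every self-map `r` with `f ∘ r = f` fixes a certain circle `C` pointwise.
Here `C` lies in the first stage of the longpipe or in the sealing disc and is parallel to the
manifold boundary of the longpipe. This contradicts eventual constancy as soon as the image of `r`
is contained in a Lindelöf set, as follows.

*The rigid function.* Choose disjoint discs `Dₙ` in a cylinder which accumulate exactly at
`C`, and let `f` be zero off these discs and `wobble n` of the normalized distance to the boundary
on `Dₙ`. As `f` is positive exactly on the discs, connectedness shows that `r` maps a radial segment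
of `Dₙ` into a single `Dₘ`, so that `wobble n = wobble m ∘ a` for a continuous
`a : [0, 1] → [0, 1]`. The profiles are chosen so that this forces `m = n`
(`eq_of_wobble_eq_comp`): their maxima decrease with `n`, and so do their relative oscillations
near `0`. Hence `r` maps the center of `Dₙ` into `Dₙ`, and in the limit it fixes the points of `C`
(`apply_eq_of_rigidFunction_comp`).

*The contradiction.* The image of `r` lies in one stage, a half-open cylinder with angular
coordinate `angle`. The circle-valued map `φ = angle ∘ r` is eventually constant, hence it is
constant on some circle far out, and by homotopy lifting `φ` has a logarithm on the first stage
(`IsPipeAtlas.hasLog_of_eventually_const`). As `r` is the identity on `C`, the angular coordinate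
has a logarithm on `C`, hence on the manifold boundary of the longpipe, which is parallel to `C`.
But the manifold boundary is the bottom circle of every stage
(`IsPipeAtlas.exists_eq_of_mem_surfaceBoundary`), by the topological invariance of the boundary of
the half-open cylinder, and so the angular coordinate is a homeomorphism from it to the circle and
has no logarithm (`IsPipeAtlas.not_hasLog_angle`).

*Sealed longpipes.* The cylinder is taken inside the disc, and `f` gets an additional dip at the
center of the disc, which forces `r` to preserve the complement of the center. The argument
applies to `r` followed by the radial retraction of this complement to the longpipe.
-/

open Set Topology unitInterval

/-! ### Circle-valued functions and their logarithms -/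

/-- A circle-valued function has a logarithm if it lifts to a continuous real-valued function
through the covering `Circle.exp : ℝ → Circle`. No continuity of `f` is assumed: it follows. -/
def HasLog {Y : Type*} [TopologicalSpace Y] (f : Y → Circle) : Prop :=
  ∃ g : Y → ℝ, Continuous g ∧ ∀ y, Circle.exp (g y) = f y

theorem HasLog.comp {Y W : Type*} [TopologicalSpace Y] [TopologicalSpace W] {f : Y → Circle}
    (hf : HasLog f) {k : W → Y} (hk : Continuous k) : HasLog fun w => f (k w) := by
  obtain ⟨g, hg, h⟩ := hf
  exact ⟨g ∘ k, hg.comp hk, fun w => h _⟩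

theorem hasLog_const {Y : Type*} [TopologicalSpace Y] (c : Circle) : HasLog fun _ : Y => c :=
  ⟨fun _ => Complex.arg c, continuous_const, fun _ => Circle.exp_arg c⟩

/-- Having a logarithm is invariant under homotopy, by homotopy lifting for `Circle.exp`. -/
theorem HasLog.of_homotopy {Y : Type*} [TopologicalSpace Y] {H : I × Y → Circle}
    (hH : Continuous H) (h₀ : HasLog fun y => H (0, y)) (t : I) : HasLog fun y => H (t, y) := by
  obtain ⟨g, hg, h⟩ := h₀
  let G := Circle.isCoveringMap_exp.liftHomotopy ⟨H, hH⟩ ⟨g, hg⟩ fun a => (h a).symm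
  refine ⟨fun y => G (t, y), by fun_prop, fun y => ?_⟩
  exact congrFun (Circle.isCoveringMap_exp.liftHomotopy_lifts ⟨H, hH⟩ ⟨g, hg⟩ _) (t, y)

/-- On a product with an interval, a logarithm on one slice extends to a logarithm. -/
theorem HasLog.of_slice {A : Type*} [TopologicalSpace A] {s : Set ℝ} (hs : Convex ℝ s)
    {f : A × s → Circle} (hf : Continuous f) (t₀ : s) (h : HasLog fun a => f (a, t₀)) :
    HasLog f := by
  let H : I × (A × s) → Circle := fun p =>
    f (p.2.1, ⟨(1 - (p.1 : ℝ)) * t₀ + p.1 * p.2.2,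
      hs t₀.2 p.2.2.2 (by linarith [p.1.2.2]) p.1.2.1 (by ring)⟩)
  have hH : Continuous H := by
    refine hf.comp (Continuous.prodMk (by fun_prop) (Continuous.subtype_mk (by fun_prop) _))
  have := HasLog.of_homotopy hH (by simpa [H] using h.comp continuous_fst) 1
  simpa [H] using this

/-- The identity of the circle has no logarithm: a logarithm `g` would be injective, but by the
intermediate value theorem `g z = g (-z)` for some `z`. -/
theorem not_hasLog_id : ¬ HasLog fun z : Circle => z := by
  rintro ⟨g, hg, h⟩
  let k : ℝ → ℝ := fun x => g (Circle.exp x) - g (Circle.exp (x + Real.pi))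
  have hk : Continuous k := by fun_prop
  have hper : k Real.pi = - k 0 := by
    have : Real.pi + Real.pi = 2 * Real.pi := by ring
    simp only [k, this, Circle.exp_two_pi, Circle.exp_zero, zero_add]
    ring
  obtain ⟨x, hx⟩ : ∃ x, k x = 0 := by
    rcases le_total (k 0) 0 with h0 | h0
    · exact mem_range_of_exists_le_of_exists_ge hk ⟨0, h0⟩ ⟨Real.pi, by linarith⟩
    · exact mem_range_of_exists_le_of_exists_ge hk ⟨Real.pi, by linarith⟩ ⟨0, h0⟩
  have h1 : Circle.exp x = Circle.exp (x + Real.pi) := by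
    exact (h _).symm.trans ((congrArg _ (sub_eq_zero.1 hx)).trans (h _))
  rw [Circle.exp_eq_exp] at h1
  obtain ⟨m, hm⟩ := h1
  have h2 : ((2 * m + 1 : ℤ) : ℝ) * Real.pi = 0 := by push_cast; linarith
  have h3 : ((2 * m + 1 : ℤ) : ℝ) = 0 := (mul_eq_zero.1 h2).resolve_right Real.pi_ne_zero
  have : (2 * m + 1 : ℤ) = 0 := by exact_mod_cast h3
  omega

/-- The direction `w / ‖w‖` of a nonzero complex number, with value `1` at `0`. -/
noncomputable def direction (w : ℂ) : Circle :=
  if h : w = 0 then 1 else ⟨w / ‖w‖, by simp [Submonoid.unitSphere, h]⟩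

theorem isEmbedding_coe_circle : IsEmbedding fun z : Circle => (z : ℂ) :=
  .subtypeVal

theorem coe_direction {w : ℂ} (hw : w ≠ 0) : (direction w : ℂ) = w / ‖w‖ := by
  simp [direction, hw]

theorem continuousAt_direction {w : ℂ} (hw : w ≠ 0) : ContinuousAt direction w := by
  have : ContinuousAt (fun w : ℂ => w / ‖w‖) w :=
    continuousAt_id.div (by fun_prop) (by simpa using hw)
  rw [isEmbedding_coe_circle.continuousAt_iff]
  refine this.congr ?_
  filter_upwards [isOpen_ne.mem_nhds hw] with v hv
  exact (coe_direction hv).symm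

theorem direction_mul {t : ℝ} (ht : 0 < t) (z : Circle) : direction (t * z) = z := by
  have h : (t : ℂ) ≠ 0 := by exact_mod_cast ht.ne'
  ext
  rw [coe_direction (mul_ne_zero h z.coe_ne_zero)]
  rw [norm_mul, Circle.norm_coe, Complex.norm_real, Real.norm_of_nonneg ht.le]
  push_cast
  field_simp

/-! ### The manifold boundary -/

theorem notMem_surfaceBoundary_iff {X : Type*} [TopologicalSpace X] {x : X} :
    x ∉ surfaceBoundary X ↔
      ∃ i : EuclideanSpace ℝ (Fin 2) → X, IsOpenEmbedding i ∧ x ∈ range i := by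
  simp only [surfaceBoundary, mem_ofPred_eq, not_not]
  constructor
  · rintro ⟨U, hU, hx, ⟨h⟩⟩
    refine ⟨Subtype.val ∘ h.symm, hU.isOpenEmbedding_subtypeVal.comp h.symm.isOpenEmbedding,
      h ⟨x, hx⟩, by simp⟩
  · rintro ⟨i, hi, hx⟩
    exact ⟨range i, hi.isOpen_range, hx, ⟨hi.isEmbedding.toHomeomorph.symm⟩⟩

/-- The manifold boundary is a local notion: it is compatible with open embeddings. -/
theorem mem_surfaceBoundary_iff_of_isOpenEmbedding {X Y : Type*} [TopologicalSpace X]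
    [TopologicalSpace Y] {f : X → Y} (hf : IsOpenEmbedding f) (x : X) :
    f x ∈ surfaceBoundary Y ↔ x ∈ surfaceBoundary X := by
  rw [← not_iff_not, notMem_surfaceBoundary_iff, notMem_surfaceBoundary_iff]
  constructor
  · rintro ⟨i, hi, v, hv⟩
    -- Shrink the chart to a ball that it maps into the range of `f`.
    have hO : IsOpen (i ⁻¹' range f) := hf.isOpen_range.preimage hi.continuous
    obtain ⟨ε, hε, hball⟩ := Metric.isOpen_iff.1 hO v (by simp [hv])
    let u := OpenPartialHomeomorph.univBall v ε
    have hu : IsOpenEmbedding u :=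
      u.isOpenEmbedding (OpenPartialHomeomorph.univBall_source v ε)
    have hmem : ∀ y, i (u y) ∈ range f := fun y => hball <| by
      rw [← OpenPartialHomeomorph.univBall_target v hε]
      exact u.map_source (by simp [u])
    choose k hk using hmem
    have hfk : f ∘ k = i ∘ u := funext hk
    refine ⟨k, IsOpenEmbedding.of_comp _ hf (hfk ▸ hi.comp hu), 0, ?_⟩
    apply hf.injective
    rw [hk, ← hv]
    simp [u]
  · rintro ⟨i, hi, v, hv⟩
    exact ⟨f ∘ i, hf.comp hi, v, by simp [hv]⟩

/-- The half-open cylinder `𝕊¹ × [0, 1)`. -/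
abbrev HalfCylinder : Type := Circle × Ico (0 : ℝ) 1

theorem isOpenEmbedding_univBall {E : Type*} [NormedAddCommGroup E] [NormedSpace ℝ E]
    (c : E) (r : ℝ) : IsOpenEmbedding (OpenPartialHomeomorph.univBall c r) :=
  (OpenPartialHomeomorph.univBall c r).isOpenEmbedding (OpenPartialHomeomorph.univBall_source c r)

theorem univBall_mem_ball {E : Type*} [NormedAddCommGroup E] [NormedSpace ℝ E]
    (c : E) {r : ℝ} (hr : 0 < r) (x : E) :
    OpenPartialHomeomorph.univBall c r x ∈ Metric.ball c r := by
  rw [← OpenPartialHomeomorph.univBall_target c hr]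
  exact (OpenPartialHomeomorph.univBall c r).map_source
    (by simp)

theorem notMem_surfaceBoundary_halfCylinder {p : HalfCylinder} (hp : (p.2 : ℝ) ≠ 0) :
    p ∉ surfaceBoundary HalfCylinder := by
  obtain ⟨z, t, ht⟩ := p
  replace hp : 0 < t := lt_of_le_of_ne ht.1 (Ne.symm hp)
  rw [notMem_surfaceBoundary_iff]
  -- The chart is the product of an arc around `z` and an interval around `t`.
  let a : ℝ → Circle := fun x => Circle.exp (OpenPartialHomeomorph.univBall (Complex.arg z) 1 x)
  have ha : IsOpenEmbedding a := by
    refine .of_continuous_injective_isOpenMap ?_ ?_ ?_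
    · exact Circle.exp.continuous.comp (isOpenEmbedding_univBall _ _).continuous
    · intro x y hxy
      apply (isOpenEmbedding_univBall (Complex.arg z : ℝ) 1).injective
      have hx := univBall_mem_ball (Complex.arg z : ℝ) one_pos x
      have hy := univBall_mem_ball (Complex.arg z : ℝ) one_pos y
      obtain ⟨m, hm⟩ := Circle.exp_eq_exp.1 hxy
      rw [Real.ball_eq_Ioo] at hx hy
      have hpi := Real.pi_gt_three
      have hm0 : m = 0 := by
        have h1 : (m : ℝ) < 1 := by
          by_contra! h
          nlinarith [hx.1, hx.2, hy.1, hy.2]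
        have h2 : (-1 : ℝ) < m := by
          by_contra! h
          nlinarith [hx.1, hx.2, hy.1, hy.2]
        have h1' : m < 1 := by exact_mod_cast h1
        have h2' : -1 < m := by exact_mod_cast h2
        omega
      simpa [hm0] using hm
    · exact isLocalHomeomorph_circleExp.isOpenMap.comp (isOpenEmbedding_univBall _ _).isOpenMap
  have hε : 0 < min t (1 - t) := lt_min hp (by linarith [ht.2])
  have hb : ∀ x, OpenPartialHomeomorph.univBall t (min t (1 - t)) x ∈ Ico (0 : ℝ) 1 := by
    intro x
    have hx := univBall_mem_ball t hε x
    rw [Real.ball_eq_Ioo] at hx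
    have h1 := min_le_left t (1 - t)
    have h2 := min_le_right t (1 - t)
    exact ⟨by linarith [hx.1], by linarith [hx.2]⟩
  let b : ℝ → Ico (0 : ℝ) 1 := codRestrict _ _ hb
  have hb' : IsOpenEmbedding b := by
    refine ⟨(isOpenEmbedding_univBall _ _).isEmbedding.codRestrict _ _, ?_⟩
    have : range b = Subtype.val ⁻¹' range (OpenPartialHomeomorph.univBall t (min t (1 - t))) := by
      ext y
      simp [b]
    rw [this]
    exact (isOpenEmbedding_univBall _ _).isOpen_range.preimage continuous_subtype_val
  let h : EuclideanSpace ℝ (Fin 2) ≃ₜ ℝ × ℝ :=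
    (EuclideanSpace.equiv (Fin 2) ℝ).toHomeomorph.trans Homeomorph.finTwoArrow
  refine ⟨Prod.map a b ∘ h, (ha.prodMap hb').comp h.isOpenEmbedding, h.symm (0, 0), ?_⟩
  have h1 : a 0 = z := by simp [a]
  have h2 : b 0 = ⟨t, ht⟩ := by
    apply Subtype.ext
    simp [b]
  simp [h1, h2]

/-- Points on the bounding circle of the half-open cylinder are boundary points: they have
punctured neighborhoods that are contractible, whereas punctured neighborhoods of a point of the
plane contain essential circles. -/
theorem mem_surfaceBoundary_halfCylinder (z₀ : Circle) :
    (z₀, ⟨0, by simp⟩) ∈ surfaceBoundary HalfCylinder := by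
  by_contra hcon
  set p : HalfCylinder := (z₀, ⟨0, by simp⟩) with hp
  obtain ⟨i₀, hi₀, v, hv⟩ := notMem_surfaceBoundary_iff.1 hcon
  -- Replace the chart by one that is defined on `ℂ` and centered at the origin.
  let h : EuclideanSpace ℝ (Fin 2) ≃ₜ ℂ :=
    ((EuclideanSpace.equiv (Fin 2) ℝ).toHomeomorph.trans Homeomorph.finTwoArrow).trans
      Complex.equivRealProdCLM.symm.toHomeomorph
  let i : ℂ → HalfCylinder := i₀ ∘ h.symm ∘ Homeomorph.addLeft (h v)
  have hi : IsOpenEmbedding i :=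
    hi₀.comp (h.symm.isOpenEmbedding.comp (Homeomorph.addLeft (h v)).isOpenEmbedding)
  have hi0 : i 0 = p := by simp [i, hv]
  -- A box around `p` in arc length coordinates that lies in the range of the chart.
  let q : ℝ × Ico (0 : ℝ) 1 → HalfCylinder := fun x => (z₀ * Circle.exp x.1, x.2)
  have hq : Continuous q := by fun_prop
  obtain ⟨δ, hδ, hbox⟩ : ∃ δ > 0, Metric.ball ((0, ⟨0, by simp⟩) : ℝ × Ico (0 : ℝ) 1) δ ⊆
      q ⁻¹' range i :=
    Metric.isOpen_iff.1 (hi.isOpen_range.preimage hq) _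
      ⟨0, show i 0 = q (0, ⟨0, by simp⟩) by simp [hi0, hp, q]⟩
  replace hbox : ∀ (a : ℝ) (t : Ico (0 : ℝ) 1), |a| < δ → (t : ℝ) < δ → q (a, t) ∈ range i := by
    intro a t ha ht
    apply hbox
    rw [Metric.mem_ball, Prod.dist_eq, Subtype.dist_eq, Real.dist_eq, Real.dist_eq]
    simpa [abs_of_nonneg t.2.1] using ⟨ha, ht⟩
  -- A small circle in the chart that lies in this box.
  have hfst : Continuous fun w => ((z₀⁻¹ * (i w).1 : Circle) : ℂ) :=
    isEmbedding_coe_circle.continuous.comp (continuous_const.mul (continuous_fst.comp hi.continuous))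
  have hsnd : Continuous fun w => ((i w).2 : ℝ) :=
    continuous_subtype_val.comp (continuous_snd.comp hi.continuous)
  have hcont : ContinuousAt (fun w => |Complex.arg (z₀⁻¹ * (i w).1 : Circle)|) 0 := by
    refine ContinuousAt.abs (ContinuousAt.comp (g := Complex.arg)
      (f := fun w => ((z₀⁻¹ * (i w).1 : Circle) : ℂ)) ?_ hfst.continuousAt)
    simp [hi0, hp, Complex.continuousAt_arg]
  have hnear : ∀ᶠ w in 𝓝 (0 : ℂ), |Complex.arg (z₀⁻¹ * (i w).1 : Circle)| < δ ∧
      ((i w).2 : ℝ) < δ ∧ ((z₀⁻¹ * (i w).1 : Circle) : ℂ) ∈ Complex.slitPlane := by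
    refine .and (hcont.eventually_lt_const ?_) (.and (hsnd.continuousAt.eventually_lt_const ?_)
      (hfst.continuousAt.eventually_mem (Complex.isOpen_slitPlane.mem_nhds ?_)))
    all_goals simp [hi0, hp, hδ]
  obtain ⟨ε, hε, hball⟩ := Metric.eventually_nhds_iff_ball.1 hnear
  let c : Circle → ℂ := fun z => ((ε / 2 : ℝ) : ℂ) * z
  have hc : Continuous c := by fun_prop
  have hc0 : ∀ z, c z ≠ 0 := fun z =>
    mul_ne_zero (by exact_mod_cast (half_pos hε).ne') z.coe_ne_zero
  have hcb : ∀ z, c z ∈ Metric.ball (0 : ℂ) ε := fun z => by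
    rw [mem_ball_zero_iff, norm_mul, Circle.norm_coe, Complex.norm_real,
      Real.norm_of_nonneg (half_pos hε).le]
    linarith
  -- Contract this circle inside the punctured box, to the point `q (0, η)`.
  let η : ℝ := min δ 1 / 2
  have hmin : 0 < min δ 1 := lt_min hδ one_pos
  have hη0 : 0 < η := half_pos hmin
  have hηδ : η < δ := (half_lt_self hmin).trans_le (min_le_left _ _)
  have hη1 : η < 1 := (half_lt_self hmin).trans_le (min_le_right _ _)
  let A : Circle → ℝ := fun z => Complex.arg (z₀⁻¹ * (i (c z)).1 : Circle)
  have hA : Continuous A := by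
    rw [continuous_iff_continuousAt]
    exact fun z => ContinuousAt.comp (g := Complex.arg)
      (f := fun z => ((z₀⁻¹ * (i (c z)).1 : Circle) : ℂ))
      (Complex.continuousAt_arg (hball _ (hcb z)).2.2) (hfst.comp hc).continuousAt
  let T : Circle → Ico (0 : ℝ) 1 := fun z => (i (c z)).2
  have hT : Continuous T := continuous_snd.comp (hi.continuous.comp hc)
  have hqA : ∀ z, q (A z, T z) = i (c z) := fun z => by
    simp only [q, A, T, Circle.exp_arg]
    simp
  let S : I × Circle → Ico (0 : ℝ) 1 := fun x => ⟨x.1 * T x.2 + (1 - x.1) * η,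
    convex_Ico 0 1 (T x.2).2 ⟨hη0.le, hη1⟩ x.1.2.1 (by linarith [x.1.2.2]) (by ring)⟩
  have hS : Continuous S := Continuous.subtype_mk (by fun_prop) _
  let K : I × Circle → HalfCylinder := fun x => q (x.1 * A x.2, S x)
  have hK : Continuous K := hq.comp (by fun_prop)
  have hKmem : ∀ x, K x ∈ range i := by
    rintro ⟨s, z⟩
    obtain ⟨h1, h2, -⟩ := hball _ (hcb z)
    refine hbox _ _ ?_ ?_
    · rw [abs_mul, abs_of_nonneg s.2.1]
      exact (mul_le_of_le_one_left (abs_nonneg _) s.2.2).trans_lt h1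
    · exact convex_Iio (𝕜 := ℝ) δ h2 hηδ s.2.1 (by linarith [s.2.2]) (by ring)
  let w : I × Circle → ℂ := fun x => hi.isEmbedding.toHomeomorph.symm ⟨K x, hKmem x⟩
  have hw : Continuous w := hi.isEmbedding.toHomeomorph.symm.continuous.comp (hK.subtype_mk hKmem)
  have hiw : ∀ x, i (w x) = K x := fun x =>
    congrArg Subtype.val (hi.isEmbedding.toHomeomorph.apply_symm_apply ⟨K x, hKmem x⟩)
  have hK1 : ∀ z, K (1, z) = i (c z) := fun z => by
    rw [← hqA]
    simp [K, S]
  have hw0 : ∀ x, w x ≠ 0 := by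
    rintro ⟨s, z⟩ h0
    have h1 : K (s, z) = p := by rw [← hiw, h0, hi0]
    have h2 : (s : ℝ) * T z + (1 - s) * η = 0 := congrArg (fun y : HalfCylinder => (y.2 : ℝ)) h1
    have h3 : 0 ≤ (s : ℝ) * T z := mul_nonneg s.2.1 (T z).2.1
    have h4 : 0 ≤ (1 - (s : ℝ)) * η := mul_nonneg (by linarith [s.2.2]) hη0.le
    have h5 : (s : ℝ) = 1 := by
      have := (mul_eq_zero.1 (by linarith : (1 - (s : ℝ)) * η = 0)).resolve_right hη0.ne'
      linarith
    have h6 : s = 1 := Subtype.ext h5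
    rw [h6, hK1, ← hi0] at h1
    exact hc0 z (hi.injective h1)
  have hH : Continuous fun x => direction (w x) := by
    rw [continuous_iff_continuousAt]
    exact fun x => (continuousAt_direction (hw0 x)).comp hw.continuousAt
  have hlog := HasLog.of_homotopy hH (by
    have : ∀ z, w (0, z) = w (0, 1) := fun z => hi.injective (by
      rw [hiw, hiw]
      simp [K, S])
    simp_rw [this]
    exact hasLog_const _) 1
  refine not_hasLog_id ?_
  convert hlog using 2 with z
  rw [hi.injective ((hiw _).trans (hK1 z)), direction_mul (half_pos hε)]

theorem mem_surfaceBoundary_halfCylinder_iff (p : HalfCylinder) :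
    p ∈ surfaceBoundary HalfCylinder ↔ (p.2 : ℝ) = 0 := by
  refine ⟨fun h => not_not.1 fun h0 => notMem_surfaceBoundary_halfCylinder h0 h, fun h => ?_⟩
  obtain ⟨z, t, ht⟩ := p
  obtain rfl : t = 0 := h
  exact mem_surfaceBoundary_halfCylinder z

/-! ### Canonical covers -/

namespace IsCanonicalCover

variable {X : Type*} [TopologicalSpace X] {S : Ordinal.{0} → Set X}

theorem mono (hS : IsCanonicalCover S) {α β : Ordinal.{0}} (h : α ≤ β) (hβ : β < ω₁) :
    S α ⊆ S β := by
  rcases h.eq_or_lt with rfl | h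
  · exact subset_rfl
  · exact subset_closure.trans (hS.closure_subset α β h hβ)

theorem exists_subset_of_isLindelof (hS : IsCanonicalCover S) {Z : Set X} (hZ : IsLindelof Z) :
    ∃ α < ω₁, Z ⊆ S α := by
  obtain ⟨r, hr, hZr⟩ := hZ.elim_countable_subcover (fun α : Iio (ω₁ : Ordinal.{0}) => S α)
    (fun α => hS.isOpen α α.2) fun x _ => by
      obtain ⟨α, hα, hx⟩ := hS.exhausts x
      exact mem_iUnion.2 ⟨⟨α, hα⟩, hx⟩
  have := hr.to_subtype
  have hlt : ⨆ a : r, (a : Iio (ω₁ : Ordinal.{0})).1 < ω₁ :=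
    Ordinal.iSup_lt_omega_one fun a => a.1.2
  refine ⟨_, hlt, hZr.trans (iUnion₂_subset fun a ha => hS.mono ?_ hlt)⟩
  exact Ordinal.le_iSup (fun a : r => (a : Iio (ω₁ : Ordinal.{0})).1) ⟨a, ha⟩

end IsCanonicalCover

/-- Closed subsets of `ω`-bounded spaces are countably compact, so the Lindelöf ones are
compact. -/
theorem OmegaBounded.isCompact_of_isLindelof {X : Type*} [TopologicalSpace X]
    (hX : OmegaBounded X) {K : Set X} (hK : IsClosed K) (hL : IsLindelof K) : IsCompact K := by
  have hcc : IsCountablyCompact K := by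
    rw [isCountablyCompact_iff_seq_clusterPt]
    intro x hx
    obtain ⟨a, -, ha⟩ := (hX (range x) (countable_range x)).exists_mapClusterPt_of_frequently
      (Filter.Frequently.of_forall (f := Filter.atTop) fun n => subset_closure (mem_range_self n))
    exact ⟨a, isClosed_iff_clusterPt.1 hK a (ClusterPt.mono ha (Filter.le_principal_iff.2 hx)), ha⟩
  refine isCompact_of_finite_subcover fun U hU hKU => ?_
  obtain ⟨r, hr, hKr⟩ := hL.elim_countable_subcover U hU hKU
  obtain ⟨t, -, ht, hKt⟩ := hcc.elim_finite_subcover_image hr (fun i _ => hU i) hKr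
  exact ⟨ht.toFinset, by simpa using hKt⟩

/-! ### Charts of longpipes -/

/-- A canonical cover `S` together with parametrizations `c α` of the stages `S (α + 1)` by the
half-open cylinder. -/
structure IsPipeAtlas {P : Type*} [TopologicalSpace P] (S : Ordinal.{0} → Set P)
    (c : Ordinal.{0} → HalfCylinder → P) : Prop where
  cover : IsCanonicalCover S
  isOpenEmbedding : ∀ α < ω₁, IsOpenEmbedding (c α)
  range_eq : ∀ α < ω₁, range (c α) = S (α + 1)

theorem IsLongpipe.exists_isPipeAtlas {P : Type*} [TopologicalSpace P] (hP : IsLongpipe P) :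
    ∃ S : Ordinal.{0} → Set P, ∃ c, IsPipeAtlas S c := by
  obtain ⟨-, -, S, hS, h, -⟩ := hP
  have hsucc : ∀ α < (ω₁ : Ordinal.{0}), α + 1 < ω₁ := fun α hα =>
    (Cardinal.isSuccLimit_omega 1).succ_lt hα
  have : ∀ α, ∃ c : HalfCylinder → P, α < ω₁ → IsOpenEmbedding c ∧ range c = S (α + 1) := by
    intro α
    by_cases hα : α < ω₁
    · obtain ⟨e⟩ := h α hα
      refine ⟨Subtype.val ∘ e.symm, fun _ =>
        ⟨(hS.isOpen _ (hsucc α hα)).isOpenEmbedding_subtypeVal.comp e.symm.isOpenEmbedding, ?_⟩⟩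
      rw [e.symm.surjective.range_comp, Subtype.range_val]
    · obtain ⟨x, -⟩ := (ne_univ_iff_exists_notMem _).1 (hS.ne_univ 0 (Ordinal.omega_pos 1))
      exact ⟨fun _ => x, fun h => absurd h hα⟩
  choose c hc using this
  exact ⟨S, c, hS, fun α hα => (hc α hα).1, fun α hα => (hc α hα).2⟩

/-- The basepoint of the interval factor of the half-open cylinder. -/
def bottom : Ico (0 : ℝ) 1 := ⟨0, by simp⟩

instance : Nonempty HalfCylinder := ⟨(1, bottom)⟩

/-- The angular coordinate of a parametrization `c` by the half-open cylinder (arbitrary outside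
of the range of `c`). -/
noncomputable def angle {P : Type*} (c : HalfCylinder → P) (x : P) : Circle :=
  (Function.invFun c x).1

theorem angle_apply {P : Type*} {c : HalfCylinder → P} (hc : Function.Injective c)
    (y : HalfCylinder) : angle c (c y) = y.1 := by
  rw [angle, Function.leftInverse_invFun hc]

theorem continuousAt_angle {P : Type*} [TopologicalSpace P] {c : HalfCylinder → P}
    (hc : IsOpenEmbedding c) {x : P} (hx : x ∈ range c) : ContinuousAt (angle c) x := by
  obtain ⟨y, rfl⟩ := hx
  rw [← hc.continuousAt_iff]
  have : angle c ∘ c = Prod.fst := funext fun y => angle_apply hc.injective y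
  rw [this]
  exact continuousAt_fst

namespace IsPipeAtlas

variable {P : Type*} [TopologicalSpace P] {S : Ordinal.{0} → Set P}
  {c : Ordinal.{0} → HalfCylinder → P}

theorem range_mono (hc : IsPipeAtlas S c) {α β : Ordinal.{0}} (h : α ≤ β) (hβ : β < ω₁) :
    range (c α) ⊆ range (c β) := by
  rw [hc.range_eq α (h.trans_lt hβ), hc.range_eq β hβ]
  exact hc.cover.mono (by gcongr) ((Cardinal.isSuccLimit_omega 1).succ_lt hβ)

theorem exists_subset_range (hc : IsPipeAtlas S c) {Z : Set P} (hZ : IsLindelof Z) :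
    ∃ α < ω₁, Z ⊆ range (c α) := by
  obtain ⟨α, hα, hZα⟩ := hc.cover.exists_subset_of_isLindelof hZ
  refine ⟨α, hα, ?_⟩
  rw [hc.range_eq α hα]
  exact hZα.trans (hc.cover.mono (Order.le_succ α)
    ((Cardinal.isSuccLimit_omega 1).succ_lt hα))

theorem mem_surfaceBoundary_iff (hc : IsPipeAtlas S c) {α : Ordinal.{0}} (hα : α < ω₁)
    (y : HalfCylinder) : c α y ∈ surfaceBoundary P ↔ (y.2 : ℝ) = 0 := by
  rw [mem_surfaceBoundary_iff_of_isOpenEmbedding (hc.isOpenEmbedding α hα),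
    mem_surfaceBoundary_halfCylinder_iff]

/-- The manifold boundary is already visible in the first chart: its trace on the first stage is
open and closed in its trace on every later stage, which is a circle and thus connected. -/
theorem exists_eq_of_mem_surfaceBoundary [T2Space P] (hc : IsPipeAtlas S c) {x : P}
    (hx : x ∈ surfaceBoundary P) : ∃ z : Circle, c 0 (z, bottom) = x := by
  have h0 : (0 : Ordinal.{0}) < ω₁ := Ordinal.omega_pos 1
  obtain ⟨α, hα, hxα⟩ := hc.exists_subset_range (isLindelof_singleton (x := x))
  obtain ⟨⟨w, t⟩, rfl⟩ := hxα rfl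
  obtain rfl : t = bottom := Subtype.ext ((hc.mem_surfaceBoundary_iff hα _).1 hx)
  let k : Circle → P := fun z => c α (z, bottom)
  have hk : Continuous k := (hc.isOpenEmbedding α hα).continuous.comp (by fun_prop)
  let Γ : Set P := range fun z : Circle => c 0 (z, bottom)
  have hΓ : IsCompact Γ :=
    isCompact_range ((hc.isOpenEmbedding 0 h0).continuous.comp (by fun_prop))
  have heq : k ⁻¹' Γ = k ⁻¹' range (c 0) := by
    ext z
    refine ⟨fun ⟨y, hy⟩ => ⟨_, hy⟩, fun ⟨⟨y, s⟩, hy⟩ => ⟨y, ?_⟩⟩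
    have : c 0 (y, s) ∈ surfaceBoundary P := by
      rw [hy]
      exact (hc.mem_surfaceBoundary_iff hα _).2 rfl
    obtain rfl : s = bottom := Subtype.ext ((hc.mem_surfaceBoundary_iff h0 _).1 this)
    exact hy
  have hclopen : IsClopen (k ⁻¹' Γ) :=
    ⟨hΓ.isClosed.preimage hk, heq ▸ (hc.isOpenEmbedding 0 h0).isOpen_range.preimage hk⟩
  have hne : (k ⁻¹' Γ).Nonempty := by
    obtain ⟨⟨z, s⟩, hz⟩ := hc.range_mono (zero_le (a := α)) hα ⟨(1, bottom), rfl⟩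
    have : c α (z, s) ∈ surfaceBoundary P := by
      rw [hz]
      exact (hc.mem_surfaceBoundary_iff h0 _).2 rfl
    obtain rfl : s = bottom := Subtype.ext ((hc.mem_surfaceBoundary_iff hα _).1 this)
    exact ⟨z, 1, hz.symm⟩
  exact (hclopen.eq_univ hne).ge (mem_univ w)

/-- The boundary circle is essential in every stage: the angular coordinate of a chart has no
logarithm on it. -/
theorem not_hasLog_angle [T2Space P] (hc : IsPipeAtlas S c) {α : Ordinal.{0}} (hα : α < ω₁) :
    ¬ HasLog fun z => angle (c α) (c 0 (z, bottom)) := fun h => by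
  have h0 : (0 : Ordinal.{0}) < ω₁ := Ordinal.omega_pos 1
  have hmem : ∀ z, ∃ y, c 0 (y, bottom) = c α (z, bottom) := fun z =>
    hc.exists_eq_of_mem_surfaceBoundary ((hc.mem_surfaceBoundary_iff hα _).2 rfl)
  choose k hk using hmem
  have hkc : Continuous k := by
    have h1 : Continuous fun z => (k z, bottom) := by
      rw [(hc.isOpenEmbedding 0 h0).isInducing.continuous_iff]
      exact ((hc.isOpenEmbedding α hα).continuous.comp (by fun_prop)).congr fun z => (hk z).symm
    exact continuous_fst.comp h1
  refine not_hasLog_id ?_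
  convert h.comp hkc using 2 with z
  rw [hk, angle_apply (hc.isOpenEmbedding α hα).injective]

/-- A circle-valued function that is constant outside of a Lindelöf set has a logarithm on the
first stage: it is constant on a circle far out, in the cylinder of a later stage. -/
theorem hasLog_of_eventually_const (hP : OmegaBounded P) (hc : IsPipeAtlas S c)
    {φ : P → Circle} (hφ : Continuous φ) {Z : Set P} (hZ : IsLindelof Z)
    (hφZ : ∀ x ∉ Z, ∀ y ∉ Z, φ x = φ y) : HasLog fun y => φ (c 0 y) := by
  obtain ⟨β, hβ, hZβ⟩ := hc.cover.exists_subset_of_isLindelof hZ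
  have h0 : (0 : Ordinal.{0}) < ω₁ := Ordinal.omega_pos 1
  have hcβ := hc.isOpenEmbedding β hβ
  have hK : IsCompact (closure (S β)) :=
    hP.isCompact_of_isLindelof isClosed_closure (hc.cover.isLindelof_closure β hβ)
  have hKr : closure (S β) ⊆ range (c β) := by
    rw [hc.range_eq β hβ]
    exact hc.cover.closure_subset _ _ (Order.lt_succ β) ((Cardinal.isSuccLimit_omega 1).succ_lt hβ)
  have hK' : IsCompact ((fun y : HalfCylinder => y.2) '' (c β ⁻¹' closure (S β))) :=
    (hcβ.isInducing.isCompact_preimage' hK hKr).image continuous_snd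
  obtain ⟨t, ht⟩ : ∃ t : Ico (0 : ℝ) 1, ∀ z, c β (z, t) ∉ Z := by
    rcases eq_empty_or_nonempty ((fun y : HalfCylinder => y.2) '' (c β ⁻¹' closure (S β)))
      with he | hne
    · refine ⟨bottom, fun z hz => ?_⟩
      have : bottom ∈ (fun y : HalfCylinder => y.2) '' (c β ⁻¹' closure (S β)) :=
        ⟨(z, bottom), subset_closure (hZβ hz), rfl⟩
      simp [he] at this
    · obtain ⟨s, -, hs⟩ := hK'.exists_isGreatest hne
      obtain ⟨t, hst, ht1⟩ := exists_between s.2.2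
      refine ⟨⟨t, s.2.1.trans hst.le, ht1⟩, fun z hz => ?_⟩
      exact absurd (hs ⟨(z, _), subset_closure (hZβ hz), rfl⟩) (not_le.2 hst)
  have hlog : HasLog fun y => φ (c β y) := by
    refine HasLog.of_slice (convex_Ico 0 1) (hφ.comp hcβ.continuous) t ?_
    simp_rw [fun z => hφZ _ (ht z) _ (ht 1)]
    exact hasLog_const _
  have hmem : ∀ y, ∃ y', c β y' = c 0 y := fun y => hc.range_mono (zero_le (a := β)) hβ ⟨y, rfl⟩
  choose j hj using hmem
  have hjc : Continuous j := by
    rw [hcβ.isInducing.continuous_iff]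
    exact (hc.isOpenEmbedding 0 h0).continuous.congr fun y => (hj y).symm
  simpa only [hj] using hlog.comp hjc

end IsPipeAtlas

/-! ### Wobbling height functions -/

/-- A function `[0, 1] → [0, ∞)` that vanishes only at `0` and oscillates at all small scales. For
`s < t` the quotient `wobble n s / wobble n t` is at most `exp (2 * (1 / 2) ^ n)`, and quotients
larger than `exp ((1 / 2) ^ n)` occur arbitrarily close to `0`. So the relative oscillation
determines `n`, even up to reparametrization. -/
noncomputable def wobble (n : ℕ) (t : ℝ) : ℝ :=
  (1 / 4) ^ n * (t * Real.exp ((1 / 2) ^ n * Real.sin (4 * 2 ^ n * Real.log t)))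

theorem wobble_zero (n : ℕ) : wobble n 0 = 0 := by simp [wobble]

theorem wobble_one (n : ℕ) : wobble n 1 = (1 / 4) ^ n := by simp [wobble]

theorem wobble_pos (n : ℕ) {t : ℝ} (ht : 0 < t) : 0 < wobble n t := by
  unfold wobble; positivity

theorem wobble_nonneg (n : ℕ) {t : ℝ} (ht : 0 ≤ t) : 0 ≤ wobble n t := by
  unfold wobble; positivity

theorem abs_wobble_le (n : ℕ) (t : ℝ) : |wobble n t| ≤ (1 / 4) ^ n * Real.exp 1 * |t| := by
  have h : (1 / 2 : ℝ) ^ n * Real.sin (4 * 2 ^ n * Real.log t) ≤ 1 := by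
    have h1 : (1 / 2 : ℝ) ^ n ≤ 1 := pow_le_one₀ (by norm_num) (by norm_num)
    have h2 : (0 : ℝ) ≤ (1 / 2) ^ n := by positivity
    nlinarith [Real.sin_le_one (4 * 2 ^ n * Real.log t)]
  rw [wobble, abs_mul, abs_mul, Real.abs_exp, abs_of_nonneg (by positivity : (0 : ℝ) ≤ (1 / 4) ^ n),
    mul_comm |t|, mul_assoc _ (Real.exp 1)]
  exact mul_le_mul_of_nonneg_left
    (mul_le_mul_of_nonneg_right (Real.exp_le_exp.2 h) (abs_nonneg t)) (by positivity)

theorem continuous_wobble (n : ℕ) : Continuous (wobble n) := by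
  rw [continuous_iff_continuousAt]
  intro t
  rcases eq_or_ne t 0 with rfl | ht
  · rw [ContinuousAt, wobble_zero]
    refine squeeze_zero_norm (abs_wobble_le n) ?_
    have : Continuous fun t : ℝ => (1 / 4) ^ n * Real.exp 1 * |t| := by fun_prop
    simpa using this.tendsto 0
  · unfold wobble
    have := Real.continuousAt_log ht
    fun_prop

theorem wobble_le_of_le (n : ℕ) {s t : ℝ} (hs : 0 ≤ s) (hst : s ≤ t) :
    wobble n s ≤ Real.exp (2 * (1 / 2) ^ n) * wobble n t := by
  have h : (1 / 2 : ℝ) ^ n * Real.sin (4 * 2 ^ n * Real.log s) ≤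
      2 * (1 / 2) ^ n + (1 / 2) ^ n * Real.sin (4 * 2 ^ n * Real.log t) := by
    have h2 : (0 : ℝ) ≤ (1 / 2) ^ n := by positivity
    nlinarith [Real.sin_le_one (4 * 2 ^ n * Real.log s),
      Real.neg_one_le_sin (4 * 2 ^ n * Real.log t)]
  calc wobble n s ≤ (1 / 4) ^ n * (t * Real.exp (2 * (1 / 2) ^ n +
        (1 / 2) ^ n * Real.sin (4 * 2 ^ n * Real.log t))) := by
        unfold wobble
        have := hs.trans hst
        gcongr
    _ = _ := by
        rw [Real.exp_add, wobble]
        ring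

/-- Arbitrarily close to `0`, the function `wobble m` drops by a factor `exp ((1 / 2) ^ m)`. -/
theorem exists_wobble_drop (m : ℕ) {ε : ℝ} (hε : 0 < ε) :
    ∃ s t, 0 < s ∧ s < t ∧ t < ε ∧ Real.exp ((1 / 2) ^ m) * wobble m t < wobble m s := by
  obtain ⟨k, hk⟩ := exists_nat_gt (4 * 2 ^ m * -Real.log ε + 2 * Real.pi)
  have h2 : (0 : ℝ) < 2 ^ m := by positivity
  have hpi := Real.pi_gt_three
  have hk0 : (k : ℝ) ≤ k * (2 * Real.pi) := by
    nlinarith [Nat.cast_nonneg (α := ℝ) k]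
  -- The logarithms of `s` and `t` are points where the sine is `1` and `-1`, half a period apart.
  let x : ℝ := (Real.pi / 2 - k * (2 * Real.pi)) / (4 * 2 ^ m)
  let y : ℝ := (Real.pi / 2 + Real.pi - k * (2 * Real.pi)) / (4 * 2 ^ m)
  have hx : 4 * 2 ^ m * x = Real.pi / 2 - k * (2 * Real.pi) := by
    simp only [x]; field_simp
  have hy : 4 * 2 ^ m * y = Real.pi / 2 + Real.pi - k * (2 * Real.pi) := by
    simp only [y]; field_simp
  have hsx : Real.sin (4 * 2 ^ m * x) = 1 := by
    rw [hx, Real.sin_sub_nat_mul_two_pi, Real.sin_pi_div_two]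
  have hsy : Real.sin (4 * 2 ^ m * y) = -1 := by
    rw [hy, Real.sin_sub_nat_mul_two_pi, Real.sin_add_pi, Real.sin_pi_div_two]
  have hxy : x < y := by
    have : 4 * 2 ^ m * x < 4 * 2 ^ m * y := by rw [hx, hy]; linarith
    exact lt_of_mul_lt_mul_left this (by positivity)
  refine ⟨Real.exp x, Real.exp y, Real.exp_pos x, Real.exp_lt_exp.2 hxy, ?_, ?_⟩
  · rw [← Real.lt_log_iff_exp_lt hε]
    have : 4 * 2 ^ m * y < 4 * 2 ^ m * Real.log ε := by rw [hy]; linarith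
    exact lt_of_mul_lt_mul_left this (by positivity)
  · rw [wobble, wobble, Real.log_exp, Real.log_exp, hsx, hsy, mul_left_comm]
    refine mul_lt_mul_of_pos_left ?_ (by positivity)
    rw [← Real.exp_add, ← Real.exp_add, ← Real.exp_add, Real.exp_lt_exp]
    have h1 : (1 / 2 : ℝ) ^ m * 2 ^ m = 1 := by rw [← mul_pow]; norm_num
    have h3 : y - x < (1 / 2) ^ m := by
      have h4 : 4 * 2 ^ m * (y - x) < 4 * 2 ^ m * (1 / 2) ^ m := by
        have := Real.pi_lt_four
        rw [mul_sub, hx, hy, mul_assoc, mul_comm (2 ^ m), h1]; linarith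
      exact lt_of_mul_lt_mul_left h4 (by positivity)
    linarith

/-- The functions `wobble n` do not factor through each other. -/
theorem eq_of_wobble_eq_comp {m n : ℕ} {a : ℝ → ℝ} (ha : ContinuousOn a (Icc 0 1))
    (ha' : ∀ t ∈ Icc (0 : ℝ) 1, a t ∈ Icc (0 : ℝ) 1)
    (h : ∀ t ∈ Icc (0 : ℝ) 1, wobble n t = wobble m (a t)) : m = n := by
  have h0mem : (0 : ℝ) ∈ Icc (0 : ℝ) 1 := by simp
  have h1mem : (1 : ℝ) ∈ Icc (0 : ℝ) 1 := by simp
  rcases lt_trichotomy m n with hmn | hmn | hmn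
  · -- A drop of `wobble m` is too large for `wobble n`.
    have ha0 : a 0 = 0 := by
      by_contra h0
      have := wobble_pos m (lt_of_le_of_ne (ha' 0 h0mem).1 (Ne.symm h0))
      rw [← h 0 h0mem, wobble_zero] at this
      exact lt_irrefl _ this
    have ha1 : 0 < a 1 := by
      refine lt_of_le_of_ne (ha' 1 h1mem).1 fun h1 => ?_
      have := h 1 h1mem
      rw [← h1, wobble_zero, wobble_one] at this
      exact absurd this (by positivity)
    obtain ⟨s, t, hs, hst, ht, hdrop⟩ := exists_wobble_drop m ha1
    obtain ⟨v, hv, rfl⟩ := intermediate_value_Icc zero_le_one ha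
      (show t ∈ Icc (a 0) (a 1) from ⟨by linarith, ht.le⟩)
    obtain ⟨u, hu, rfl⟩ := intermediate_value_Icc hv.1 (ha.mono (Icc_subset_Icc_right hv.2))
      (show s ∈ Icc (a 0) (a v) from ⟨by linarith, hst.le⟩)
    rw [← h v hv, ← h u ⟨hu.1, hu.2.trans hv.2⟩] at hdrop
    have h1 := wobble_le_of_le n hu.1 hu.2
    have h2 : Real.exp (2 * (1 / 2) ^ n) ≤ Real.exp ((1 / 2) ^ m) := by
      rw [Real.exp_le_exp]
      have h3 : (1 / 2 : ℝ) ^ n ≤ (1 / 2) ^ (m + 1) :=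
        pow_le_pow_of_le_one (by norm_num) (by norm_num) hmn
      rw [pow_succ] at h3
      linarith
    have h4 := mul_le_mul_of_nonneg_right h2 (wobble_nonneg n hv.1)
    linarith
  · exact hmn
  · -- The maximum of `wobble m` is too small.
    have h1 := (le_abs_self _).trans (abs_wobble_le m (a 1))
    rw [← h 1 h1mem, wobble_one, abs_of_nonneg (ha' 1 h1mem).1] at h1
    have h2 : (1 / 4 : ℝ) ^ m ≤ (1 / 4) ^ (n + 1) :=
      pow_le_pow_of_le_one (by norm_num) (by norm_num) hmn
    have h3 : Real.exp 1 < 4 := Real.exp_one_lt_d9.trans (by norm_num)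
    have h4 : (0 : ℝ) < (1 / 4) ^ n := by positivity
    have h5 : (1 / 4 : ℝ) ^ m * Real.exp 1 * a 1 ≤ (1 / 4) ^ m * Real.exp 1 * 1 := by
      gcongr
      exact (ha' 1 h1mem).2
    have h6 : (1 / 4 : ℝ) ^ m * Real.exp 1 < (1 / 4) ^ n := by
      calc (1 / 4 : ℝ) ^ m * Real.exp 1 ≤ (1 / 4) ^ (n + 1) * Real.exp 1 := by gcongr
        _ < (1 / 4) ^ (n + 1) * 4 := by gcongr
        _ = (1 / 4) ^ n := by rw [pow_succ]; ring
    linarith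

/-! ### Rigid functions -/

/-- Extension by zero along an open embedding into a Hausdorff space preserves continuity of
functions that vanish off a compact set. -/
theorem continuous_extend_zero_of_isOpenEmbedding {M X : Type*} [TopologicalSpace M]
    [TopologicalSpace X] [T2Space X] {j : M → X} (hj : IsOpenEmbedding j) {b : M → ℝ}
    (hb : Continuous b) {K : Set M} (hK : IsCompact K) (h : ∀ y ∉ K, b y = 0) :
    Continuous (Function.extend j b 0) := by
  rw [continuous_iff_continuousAt]
  intro x
  by_cases hx : x ∈ range j
  · obtain ⟨y, rfl⟩ := hx
    have : Function.extend j b 0 ∘ j = b := funext (hj.injective.extend_apply _ _)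
    rw [← hj.continuousAt_iff, this]
    exact hb.continuousAt
  · have hx' : x ∉ j '' K := fun ⟨y, _, hy⟩ => hx ⟨y, hy⟩
    refine (continuousAt_const (y := (0 : ℝ))).congr ?_
    filter_upwards [(hK.image hj.continuous).isClosed.isOpen_compl.mem_nhds hx'] with x' hx'
    by_cases hr : x' ∈ range j
    · obtain ⟨y, rfl⟩ := hr
      rw [hj.injective.extend_apply]
      exact (h y fun hy => hx' ⟨y, hy, rfl⟩).symm
    · rw [Function.extend_apply' _ _ _ hr]
      rfl

/-- The open cylinder `𝕊¹ × (0, 1)`. -/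
abbrev OpenCylinder : Type := Circle × Ioo (0 : ℝ) 1

/-- Angles of the centers of the discs below: each element of a dense sequence occurs infinitely
often. -/
noncomputable def discAngle (n : ℕ) : Circle :=
  TopologicalSpace.denseSeq Circle (Nat.unpair n).1

/-- Heights of the centers of the discs below. -/
noncomputable def discHeight (n : ℕ) : ℝ := 1 / 2 + (1 / 2) ^ n / 4

/-- Radii of the discs below. -/
noncomputable def discRadius (n : ℕ) : ℝ := (1 / 2) ^ n / 16

theorem discRadius_pos (n : ℕ) : 0 < discRadius n := by unfold discRadius; positivity

/-- Tent functions supported on a sequence of disjoint discs in the open cylinder, which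
accumulate exactly at the circle of height `1 / 2`. -/
noncomputable def tent (n : ℕ) (y : OpenCylinder) : ℝ :=
  max 0 (1 - (dist y.1 (discAngle n) + |(y.2 : ℝ) - discHeight n|) / discRadius n)

theorem continuous_tent (n : ℕ) : Continuous (tent n) := by
  unfold tent; fun_prop

theorem tent_mem_Icc (n : ℕ) (y : OpenCylinder) : tent n y ∈ Icc (0 : ℝ) 1 := by
  refine ⟨le_max_left _ _, max_le zero_le_one ?_⟩
  have : 0 ≤ (dist y.1 (discAngle n) + |(y.2 : ℝ) - discHeight n|) / discRadius n :=
    div_nonneg (by positivity) (discRadius_pos n).le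
  linarith

theorem tent_pos_iff {n : ℕ} {y : OpenCylinder} :
    0 < tent n y ↔ dist y.1 (discAngle n) + |(y.2 : ℝ) - discHeight n| < discRadius n := by
  rw [tent, lt_max_iff, sub_pos, div_lt_one (discRadius_pos n)]
  simp

theorem abs_sub_lt_of_tent_pos {n : ℕ} {y : OpenCylinder} (h : 0 < tent n y) :
    |(y.2 : ℝ) - discHeight n| < discRadius n := by
  have := tent_pos_iff.1 h
  linarith [dist_nonneg (x := y.1) (y := discAngle n)]

theorem eq_of_tent_pos {m n : ℕ} {y : OpenCylinder} (hm : 0 < tent m y) (hn : 0 < tent n y) :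
    m = n := by
  wlog hmn : m < n generalizing m n
  · rcases (not_lt.1 hmn).eq_or_lt with h | h
    · exact h.symm
    · exact (this hn hm h).symm
  have h1 := abs_lt.1 (abs_sub_lt_of_tent_pos hm)
  have h2 := abs_lt.1 (abs_sub_lt_of_tent_pos hn)
  have h3 : (1 / 2 : ℝ) ^ n ≤ (1 / 2) ^ (m + 1) :=
    pow_le_pow_of_le_one (by norm_num) (by norm_num) hmn
  have h4 : (0 : ℝ) < (1 / 2) ^ m := by positivity
  rw [pow_succ] at h3
  unfold discHeight discRadius at h1 h2
  linarith

theorem mem_Ioo_of_tent_pos {n : ℕ} {y : OpenCylinder} (h : 0 < tent n y) :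
    (y.2 : ℝ) ∈ Ioo (1 / 2 : ℝ) (7 / 8) := by
  have h1 := abs_lt.1 (abs_sub_lt_of_tent_pos h)
  have h2 : (1 / 2 : ℝ) ^ n ≤ 1 := pow_le_one₀ (by norm_num) (by norm_num)
  have h4 : (0 : ℝ) < (1 / 2) ^ n := by positivity
  unfold discHeight discRadius at h1
  constructor <;> linarith

/-- The middle height of the open cylinder. -/
noncomputable def middle : Ioo (0 : ℝ) 1 := ⟨1 / 2, by norm_num⟩

/-- The radial segment in the `n`-th disc, parametrized by the value of `tent n`. -/
noncomputable def discSegment (n : ℕ) (t : Icc (0 : ℝ) 1) : OpenCylinder :=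
  (discAngle n, ⟨discHeight n + (1 - t) * discRadius n, by
    have h2 : (1 / 2 : ℝ) ^ n ≤ 1 := pow_le_one₀ (by norm_num) (by norm_num)
    have h3 : (1 - (t : ℝ)) * discRadius n ≤ 1 * discRadius n :=
      mul_le_mul_of_nonneg_right (by linarith [t.2.1]) (discRadius_pos n).le
    have h4 : 0 ≤ (1 - (t : ℝ)) * discRadius n :=
      mul_nonneg (by linarith [t.2.2]) (discRadius_pos n).le
    have h5 : (0 : ℝ) < (1 / 2) ^ n := by positivity
    unfold discHeight
    unfold discRadius at *
    constructor <;> linarith⟩)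

theorem continuous_discSegment (n : ℕ) : Continuous (discSegment n) :=
  Continuous.prodMk continuous_const (Continuous.subtype_mk (by fun_prop) _)

theorem tent_discSegment (n : ℕ) (t : Icc (0 : ℝ) 1) : tent n (discSegment n t) = t := by
  have h0 := (discRadius_pos n).ne'
  have h1 : 0 ≤ (1 - (t : ℝ)) * discRadius n :=
    mul_nonneg (by linarith [t.2.2]) (discRadius_pos n).le
  simp only [tent, discSegment, dist_self, add_sub_cancel_left, zero_add]
  rw [abs_of_nonneg h1, mul_div_assoc, div_self h0, mul_one, sub_sub_cancel, max_eq_right t.2.1]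

/-- The discs come arbitrarily close to each point of the circle of height `1 / 2`. -/
theorem exists_tent_support_subset (z : Circle) {W : Set OpenCylinder} (hW : W ∈ 𝓝 (z, middle)) :
    ∃ n, ∀ y, 0 < tent n y → y ∈ W := by
  obtain ⟨ε, hε, hball⟩ := Metric.mem_nhds_iff.1 hW
  obtain ⟨k, hk⟩ := (TopologicalSpace.denseRange_denseSeq Circle).exists_dist_lt z (half_pos hε)
  obtain ⟨N, hN⟩ := exists_pow_lt_of_lt_one hε (by norm_num : (1 / 2 : ℝ) < 1)
  refine ⟨Nat.pair k N, fun y hy => hball ?_⟩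
  have h1 : (1 / 2 : ℝ) ^ Nat.pair k N ≤ (1 / 2) ^ N :=
    pow_le_pow_of_le_one (by norm_num) (by norm_num) (Nat.right_le_pair k N)
  have h2 := tent_pos_iff.1 hy
  have h3 := abs_lt.1 (abs_sub_lt_of_tent_pos hy)
  have h4 : dist (discAngle (Nat.pair k N)) z < ε / 2 := by
    rw [discAngle, Nat.unpair_pair, dist_comm]
    exact hk
  have h5 : (0 : ℝ) < (1 / 2) ^ Nat.pair k N := by positivity
  rw [Metric.mem_ball, Prod.dist_eq, Subtype.dist_eq, Real.dist_eq, max_lt_iff]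
  constructor
  · have h6 := dist_triangle y.1 (discAngle (Nat.pair k N)) z
    have h7 := abs_nonneg ((y.2 : ℝ) - discHeight (Nat.pair k N))
    unfold discRadius at h2
    simp only
    linarith
  · unfold discHeight discRadius at h3
    simp only [middle]
    rw [abs_lt]
    constructor <;> linarith

section Rigid

variable {X : Type*} [TopologicalSpace X] {j : OpenCylinder → X}

/-- The tent function `tent n`, transported along `j` and extended by zero. -/
noncomputable def extTent (j : OpenCylinder → X) (n : ℕ) : X → ℝ := Function.extend j (tent n) 0

theorem extTent_apply (hj : IsOpenEmbedding j) (n : ℕ) (y : OpenCylinder) :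
    extTent j n (j y) = tent n y :=
  hj.injective.extend_apply _ _ _

theorem exists_of_extTent_pos (hj : IsOpenEmbedding j) {n : ℕ} {x : X} (h : 0 < extTent j n x) :
    ∃ y, j y = x ∧ 0 < tent n y := by
  by_cases hr : x ∈ range j
  · obtain ⟨y, rfl⟩ := hr
    rw [extTent_apply hj] at h
    exact ⟨y, rfl, h⟩
  · rw [extTent, Function.extend_apply' _ _ _ hr] at h
    exact absurd h (lt_irrefl _)

theorem extTent_mem_Icc (hj : IsOpenEmbedding j) (n : ℕ) (x : X) :
    extTent j n x ∈ Icc (0 : ℝ) 1 := by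
  by_cases hr : x ∈ range j
  · obtain ⟨y, rfl⟩ := hr
    rw [extTent_apply hj]
    exact tent_mem_Icc n y
  · rw [extTent, Function.extend_apply' _ _ _ hr]
    simp

theorem eq_of_extTent_pos (hj : IsOpenEmbedding j) {m n : ℕ} {x : X} (hm : 0 < extTent j m x)
    (hn : 0 < extTent j n x) : m = n := by
  obtain ⟨y, rfl, h⟩ := exists_of_extTent_pos hj hm
  rw [extTent_apply hj] at hn
  exact eq_of_tent_pos h hn

/-- The function on `X` that has the profile `wobble n` on the `n`-th disc and vanishes
elsewhere. -/
noncomputable def rigidFunction (j : OpenCylinder → X) (x : X) : ℝ :=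
  ∑' n, wobble n (extTent j n x)

theorem rigidFunction_eq_of_pos (hj : IsOpenEmbedding j) {n : ℕ} {x : X}
    (h : 0 < extTent j n x) : rigidFunction j x = wobble n (extTent j n x) := by
  refine tsum_eq_single n fun m hm => ?_
  have : extTent j m x = 0 := le_antisymm
    (not_lt.1 fun h' => hm (eq_of_extTent_pos hj h' h)) (extTent_mem_Icc hj m x).1
  rw [this, wobble_zero]

theorem rigidFunction_nonneg (hj : IsOpenEmbedding j) (x : X) : 0 ≤ rigidFunction j x :=
  tsum_nonneg fun n => wobble_nonneg n (extTent_mem_Icc hj n x).1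

theorem exists_extTent_pos (hj : IsOpenEmbedding j) {x : X} (h : 0 < rigidFunction j x) :
    ∃ n, 0 < extTent j n x := by
  by_contra! hcon
  have : ∀ n, extTent j n x = 0 := fun n => le_antisymm (hcon n) (extTent_mem_Icc hj n x).1
  simp [rigidFunction, this, wobble_zero] at h

theorem rigidFunction_pos (hj : IsOpenEmbedding j) {n : ℕ} {x : X} (h : 0 < extTent j n x) :
    0 < rigidFunction j x := by
  rw [rigidFunction_eq_of_pos hj h]
  exact wobble_pos n h

theorem exists_of_rigidFunction_pos (hj : IsOpenEmbedding j) {x : X}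
    (h : 0 < rigidFunction j x) : ∃ y : OpenCylinder, j y = x ∧ 1 / 2 < (y.2 : ℝ) := by
  obtain ⟨n, hn⟩ := exists_extTent_pos hj h
  obtain ⟨y, hy, hpos⟩ := exists_of_extTent_pos hj hn
  exact ⟨y, hy, (mem_Ioo_of_tent_pos hpos).1⟩

variable [T2Space X]

theorem continuous_extTent (hj : IsOpenEmbedding j) (n : ℕ) : Continuous (extTent j n) := by
  let k : Circle × Icc (1 / 2 : ℝ) (7 / 8) → OpenCylinder := fun y =>
    (y.1, ⟨y.2, by linarith [y.2.2.1], by linarith [y.2.2.2]⟩)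
  have hk : Continuous k := by
    exact Continuous.prodMk continuous_fst (Continuous.subtype_mk (by fun_prop) _)
  refine continuous_extend_zero_of_isOpenEmbedding hj (continuous_tent n) (isCompact_range hk) ?_
  intro y hy
  refine le_antisymm (not_lt.1 fun h => hy ?_) (tent_mem_Icc n y).1
  have := mem_Ioo_of_tent_pos h
  exact ⟨(y.1, ⟨y.2, this.1.le, this.2.le⟩), rfl⟩

theorem continuous_rigidFunction (hj : IsOpenEmbedding j) : Continuous (rigidFunction j) := by
  refine continuous_tsum (u := fun n => (1 / 4) ^ n * Real.exp 1)
    (fun n => (continuous_wobble n).comp (continuous_extTent hj n))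
    ((summable_geometric_of_lt_one (by norm_num) (by norm_num)).mul_right _) fun n x => ?_
  have h := extTent_mem_Icc hj n x
  refine (abs_wobble_le n _).trans (mul_le_of_le_one_right (by positivity) ?_)
  rw [abs_of_nonneg h.1]
  exact h.2

/-- A self-map that preserves the rigid function maps the center of each disc into the same
disc. -/
theorem extTent_center_pos (hj : IsOpenEmbedding j) {r : X → X} (hr : Continuous r)
    (h : ∀ x, rigidFunction j (r x) = rigidFunction j x) (n : ℕ) :
    0 < extTent j n (r (j (discSegment n 1))) := by
  let γ : ℝ → X := fun t => r (j (discSegment n (projIcc 0 1 zero_le_one t)))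
  have hγ : Continuous γ := hr.comp (hj.continuous.comp
    ((continuous_discSegment n).comp continuous_projIcc))
  have htent : ∀ t ∈ Icc (0 : ℝ) 1,
      extTent j n (j (discSegment n (projIcc 0 1 zero_le_one t))) = t := fun t ht => by
    rw [extTent_apply hj, tent_discSegment, projIcc_of_mem _ ht]
  have hf : ∀ t ∈ Ioc (0 : ℝ) 1, rigidFunction j (γ t) = wobble n t := fun t ht => by
    have h1 := htent t ⟨ht.1.le, ht.2⟩
    rw [h, rigidFunction_eq_of_pos hj (n := n) (by rw [h1]; exact ht.1), h1]
  have hf0 : rigidFunction j (γ 0) = 0 := by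
    have heq : EqOn (rigidFunction j ∘ γ) (wobble n) (closure (Ioc 0 1)) :=
      EqOn.closure hf ((continuous_rigidFunction hj).comp hγ) (continuous_wobble n)
    rw [closure_Ioc zero_ne_one] at heq
    exact (heq (by simp)).trans (wobble_zero n)
  have hone : γ 1 = r (j (discSegment n 1)) := by simp [γ]
  obtain ⟨m, hm⟩ : ∃ m, 0 < extTent j m (γ 1) := exists_extTent_pos hj (by
    rw [hf 1 (by simp)]
    exact wobble_pos n one_pos)
  -- By connectedness, the image of the half-open segment lies in a single disc.
  have hsub : ∀ t ∈ Ioc (0 : ℝ) 1, 0 < extTent j m (γ t) := by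
    have hopen : ∀ k, IsOpen {t | 0 < extTent j k (γ t)} := fun k =>
      isOpen_lt continuous_const ((continuous_extTent hj k).comp hγ)
    have hsub := isPreconnected_Ioc.subset_left_of_subset_union (s := Ioc (0 : ℝ) 1) (hopen m)
      (isOpen_biUnion fun k (_ : k ∈ {k | k ≠ m}) => hopen k) ?_ ?_ ⟨1, by simp, hm⟩
    · exact hsub
    · rw [Set.disjoint_left]
      intro t ht ht'
      obtain ⟨k, hk, hkt⟩ := mem_iUnion₂.1 ht'
      exact hk (eq_of_extTent_pos hj hkt ht)
    · intro t ht
      obtain ⟨k, hk⟩ := exists_extTent_pos hj (x := γ t) (by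
        rw [hf t ht]
        exact wobble_pos n ht.1)
      by_cases hkm : k = m
      · exact Or.inl (hkm ▸ hk)
      · exact Or.inr (mem_iUnion₂.2 ⟨k, hkm, hk⟩)
  have hmn : m = n := by
    refine eq_of_wobble_eq_comp (a := fun t => extTent j m (γ t))
      ((continuous_extTent hj m).comp hγ).continuousOn (fun t _ => extTent_mem_Icc hj m _)
      fun t ht => ?_
    rcases ht.1.eq_or_lt with rfl | h0
    · have : extTent j m (γ 0) = 0 := by
        refine le_antisymm (not_lt.1 fun hpos => ?_) (extTent_mem_Icc hj m _).1
        exact (rigidFunction_pos hj hpos).ne' hf0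
      rw [this, wobble_zero, wobble_zero]
    · rw [← hf t ⟨h0, ht.2⟩, rigidFunction_eq_of_pos hj (hsub t ⟨h0, ht.2⟩)]
  rw [← hone, ← hmn]
  exact hm

/-- A self-map that preserves the rigid function fixes the circle at which the discs
accumulate. -/
theorem apply_eq_of_rigidFunction_comp (hj : IsOpenEmbedding j) {r : X → X} (hr : Continuous r)
    (h : ∀ x, rigidFunction j (r x) = rigidFunction j x) (z : Circle) :
    r (j (z, middle)) = j (z, middle) := by
  by_contra hne
  obtain ⟨V, U, hV, hU, hxV, hxU, hVU⟩ := t2_separation hne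
  have hW : j ⁻¹' (U ∩ r ⁻¹' V) ∈ 𝓝 (z, middle) :=
    ((hU.inter (hV.preimage hr)).preimage hj.continuous).mem_nhds ⟨hxU, hxV⟩
  obtain ⟨n, hn⟩ := exists_tent_support_subset z hW
  have h1 : discSegment n 1 ∈ j ⁻¹' (U ∩ r ⁻¹' V) :=
    hn _ (by rw [tent_discSegment]; exact one_pos)
  obtain ⟨y, hy, hpos⟩ := exists_of_extTent_pos hj (extTent_center_pos hj hr h n)
  exact Set.disjoint_left.1 hVU h1.2 (hy ▸ (hn y hpos).1)

end Rigid

/-! ### Longpipes -/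

theorem EventuallyConstant.complex {X : Type*} [TopologicalSpace X]
    (hX : EventuallyConstant X ℝ) {Φ : X → ℂ} (hΦ : Continuous Φ) :
    ∃ Z : Set X, IsLindelof Z ∧ ∀ x ∉ Z, ∀ y ∉ Z, Φ x = Φ y := by
  obtain ⟨Z₁, hZ₁, a, ha⟩ := hX ⟨fun x => (Φ x).re, by fun_prop⟩
  obtain ⟨Z₂, hZ₂, b, hb⟩ := hX ⟨fun x => (Φ x).im, by fun_prop⟩
  have hre : ∀ x ∉ Z₁, (Φ x).re = a := fun x hx => ha.subset ⟨x, hx, rfl⟩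
  have him : ∀ x ∉ Z₂, (Φ x).im = b := fun x hx => hb.subset ⟨x, hx, rfl⟩
  refine ⟨Z₁ ∪ Z₂, hZ₁.union hZ₂, fun x hx y hy => ?_⟩
  rw [mem_union, not_or] at hx hy
  exact Complex.ext ((hre x hx.1).trans (hre y hy.1).symm) ((him x hx.2).trans (him y hy.2).symm)

/-- Eventual constancy passes to circle-valued maps. The conclusion is that the map is constant off
a Lindelöf set, whose complement may here be empty. -/
theorem EventuallyConstant.circle {X : Type*} [TopologicalSpace X]
    (hX : EventuallyConstant X ℝ) {φ : X → Circle} (hφ : Continuous φ) :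
    ∃ Z : Set X, IsLindelof Z ∧ ∀ x ∉ Z, ∀ y ∉ Z, φ x = φ y := by
  obtain ⟨Z, hZ, h⟩ := hX.complex (isEmbedding_coe_circle.continuous.comp hφ)
  exact ⟨Z, hZ, fun x hx y hy => Circle.ext (h x hx y hy)⟩

theorem isOpenEmbedding_inclusion_Ioo_Ico :
    IsOpenEmbedding (inclusion (Ioo_subset_Ico_self : Ioo (0 : ℝ) 1 ⊆ Ico 0 1)) := by
  refine ⟨.inclusion _, ?_⟩
  rw [range_inclusion]
  exact isOpen_Ioo.preimage continuous_subtype_val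

/-- For a longpipe, the rigid function lives in the first stage, above the manifold boundary. -/
theorem IsLongpipe.not_almostStagnates {X : Type*} [TopologicalSpace X] (hX : IsLongpipe X)
    (hEC : EventuallyConstant X ℝ) : ¬ AlmostStagnates X ℝ := by
  intro hS
  have := hX.1
  obtain ⟨S, c, hc⟩ := hX.exists_isPipeAtlas
  have hc0 := hc.isOpenEmbedding 0 (Ordinal.omega_pos 1)
  let i : OpenCylinder → HalfCylinder := Prod.map id (inclusion Ioo_subset_Ico_self)
  have hj : IsOpenEmbedding (c 0 ∘ i) :=
    hc0.comp (IsOpenEmbedding.id.prodMap isOpenEmbedding_inclusion_Ioo_Ico)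
  obtain ⟨Z, hZ, r, hr⟩ := hS ⟨rigidFunction (c 0 ∘ i), continuous_rigidFunction hj⟩
  have hrc : Continuous fun x => (r x : X) := continuous_subtype_val.comp r.continuous
  have hfix := apply_eq_of_rigidFunction_comp hj hrc hr
  obtain ⟨α, hα, hZα⟩ := hc.exists_subset_range hZ
  have hcα := hc.isOpenEmbedding α hα
  have hφ : Continuous fun x => angle (c α) (r x) := by
    rw [continuous_iff_continuousAt]
    exact fun x => (continuousAt_angle hcα (hZα (r x).2)).comp (f := fun x => (r x : X))
      hrc.continuousAt
  obtain ⟨Z', hZ', hconst⟩ := hEC.circle hφ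
  have hlog := hc.hasLog_of_eventually_const hX.2.1 hφ hZ' hconst
  have hmid : HasLog fun z : Circle => angle (c α) (c 0 (i (z, middle))) := by
    have h1 : Continuous fun z : Circle => i (z, middle) :=
      (IsOpenEmbedding.id.prodMap isOpenEmbedding_inclusion_Ioo_Ico).continuous.comp (by fun_prop)
    convert hlog.comp h1 using 3 with z
    exact (hfix z).symm
  have hcont : Continuous fun y => angle (c α) (c 0 y) := by
    rw [continuous_iff_continuousAt]
    exact fun y => (continuousAt_angle hcα (hc.range_mono zero_le hα ⟨y, rfl⟩)).comp
      hc0.continuous.continuousAt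
  exact hc.not_hasLog_angle hα ((HasLog.of_slice (convex_Ico 0 1) hcont _ hmid).comp
    (k := fun z => (z, bottom)) (by fun_prop))

/-! ### Sealed longpipes -/

/-- The closed unit disc. -/
abbrev ClosedDisc : Type := Metric.closedBall (0 : ℂ) 1

theorem ClosedDisc.norm_le_one (w : ClosedDisc) : ‖(w : ℂ)‖ ≤ 1 :=
  mem_closedBall_zero_iff.1 w.2

theorem norm_ofReal_mul_circle {t : ℝ} (ht : 0 ≤ t) (z : Circle) : ‖(t : ℂ) * z‖ = t := by
  rw [norm_mul, Circle.norm_coe, mul_one, Complex.norm_real, Real.norm_of_nonneg ht]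

/-- Polar coordinates on the closed disc. -/
def polar (y : Circle × Icc (0 : ℝ) 1) : ClosedDisc :=
  ⟨(y.2 : ℝ) * (y.1 : ℂ), by
    rw [mem_closedBall_zero_iff, norm_ofReal_mul_circle y.2.2.1]
    exact y.2.2.2⟩

theorem norm_polar (y : Circle × Icc (0 : ℝ) 1) : ‖(polar y : ℂ)‖ = y.2 :=
  norm_ofReal_mul_circle y.2.2.1 y.1

theorem continuous_polar : Continuous polar :=
  Continuous.subtype_mk (by fun_prop) _

theorem direction_polar {y : Circle × Icc (0 : ℝ) 1} (hy : 0 < (y.2 : ℝ)) :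
    direction (polar y : ℂ) = y.1 :=
  direction_mul hy y.1

theorem polar_direction_norm (w : ClosedDisc) :
    polar (direction w, ⟨‖(w : ℂ)‖, norm_nonneg _, w.norm_le_one⟩) = w := by
  apply Subtype.ext
  by_cases hw : (w : ℂ) = 0
  · simp [polar, hw]
  · have h : ((‖(w : ℂ)‖ : ℝ) : ℂ) ≠ 0 := by simpa using hw
    simp only [polar, coe_direction hw]
    field_simp

/-- Polar coordinates are an open embedding off the origin and the bounding circle. -/
theorem isOpenEmbedding_polar : IsOpenEmbedding fun y : OpenCylinder =>
    polar (y.1, inclusion Ioo_subset_Icc_self y.2) := by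
  have hk : Continuous fun y : OpenCylinder => polar (y.1, inclusion Ioo_subset_Icc_self y.2) :=
    continuous_polar.comp (continuous_fst.prodMk
      ((continuous_inclusion Ioo_subset_Icc_self).comp continuous_snd))
  let g : ClosedDisc → Circle × ℝ := fun w => (direction w, ‖(w : ℂ)‖)
  have hE : IsEmbedding fun y : OpenCylinder => (y.1, (y.2 : ℝ)) :=
    IsEmbedding.id.prodMap IsEmbedding.subtypeVal
  have hgk : ∀ y : OpenCylinder, g (polar (y.1, inclusion Ioo_subset_Icc_self y.2)) =
      (y.1, (y.2 : ℝ)) := fun y => by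
    simp only [g, norm_polar]
    rw [direction_polar (y := (y.1, inclusion Ioo_subset_Icc_self y.2)) y.2.2.1]
  refine ⟨⟨isInducing_iff_nhds.2 fun y => le_antisymm hk.continuousAt.le_comap ?_, ?_⟩, ?_⟩
  · have hg : ContinuousAt g (polar (y.1, inclusion Ioo_subset_Icc_self y.2)) := by
      have hne : (polar (y.1, inclusion Ioo_subset_Icc_self y.2) : ℂ) ≠ 0 := by
        rw [← norm_pos_iff, norm_polar]
        exact y.2.2.1
      exact ((continuousAt_direction hne).comp continuous_subtype_val.continuousAt).prodMk
        (by fun_prop)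
    rw [hE.isInducing.nhds_eq_comap]
    refine Filter.Tendsto.le_comap ?_
    rw [← hgk]
    exact (hg.tendsto.comp Filter.tendsto_comap).congr fun y => hgk y
  · intro y y' h
    have h1 := congrArg g h
    rw [hgk, hgk] at h1
    exact hE.injective h1
  · have : (range fun y : OpenCylinder => polar (y.1, inclusion Ioo_subset_Icc_self y.2)) =
        {w : ClosedDisc | ‖(w : ℂ)‖ ∈ Ioo (0 : ℝ) 1} := by
      ext w
      constructor
      · rintro ⟨y, rfl⟩
        simp only [mem_ofPred_eq, norm_polar]
        exact y.2.2
      · intro hw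
        exact ⟨(direction w, ⟨_, hw⟩), polar_direction_norm w⟩
    rw [this]
    exact isOpen_Ioo.preimage (by fun_prop)

/-- The data of a sealed longpipe: a closed set `P` and an embedded closed disc which cover the
space and meet in the bounding circle of the disc, which is the manifold boundary of `P`. -/
structure IsSealing {X : Type*} [TopologicalSpace X] (e : ClosedDisc → X) (P : Set X) : Prop where
  isEmbedding : IsEmbedding e
  isClosed : IsClosed P
  mem_iff : ∀ w, e w ∈ P ↔ ‖(w : ℂ)‖ = 1
  exists_of_notMem : ∀ x ∉ P, ∃ w, e w = x
  image_circle : e '' {w | ‖(w : ℂ)‖ = 1} = Subtype.val '' surfaceBoundary P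

namespace IsSealing

variable {X : Type*} {e : ClosedDisc → X} {P : Set X}

open Classical in
/-- The radial function of the disc, extended by `1` to `P`. -/
noncomputable def radius (e : ClosedDisc → X) (P : Set X) (x : X) : ℝ :=
  if x ∈ P then 1 else ‖((Function.invFun e x : ClosedDisc) : ℂ)‖

theorem radius_of_mem {x : X} (hx : x ∈ P) : radius e P x = 1 := if_pos hx

theorem radius_nonneg (x : X) : 0 ≤ radius e P x := by
  unfold radius
  split_ifs
  · exact zero_le_one
  · exact norm_nonneg _

variable [TopologicalSpace X]

/-- The bounding circle of the disc, as a loop in `P`. -/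
noncomputable def loop (he : IsSealing e P) (z : Circle) : P :=
  ⟨e (polar (z, 1)), (he.mem_iff _).2 (by rw [norm_polar]; rfl)⟩

theorem continuous_loop (he : IsSealing e P) : Continuous he.loop :=
  Continuous.subtype_mk (he.isEmbedding.continuous.comp (continuous_polar.comp (by fun_prop))) _

theorem injective_loop (he : IsSealing e P) : Function.Injective he.loop := by
  intro z z' h
  have h1 := he.isEmbedding.injective (congrArg Subtype.val h)
  have h2 : direction (polar (z, 1) : ℂ) = direction (polar (z', 1) : ℂ) := by rw [h1]
  rwa [direction_polar, direction_polar] at h2 <;> exact one_pos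

theorem range_loop (he : IsSealing e P) : range he.loop = surfaceBoundary P := by
  apply Subtype.val_injective.image_injective
  rw [← he.image_circle, ← range_comp]
  ext x
  constructor
  · rintro ⟨z, rfl⟩
    exact ⟨_, by rw [mem_ofPred_eq, norm_polar]; rfl, rfl⟩
  · rintro ⟨w, hw, rfl⟩
    refine ⟨direction w, ?_⟩
    have h1 := polar_direction_norm w
    have h2 : (⟨‖(w : ℂ)‖, norm_nonneg _, w.norm_le_one⟩ : Icc (0 : ℝ) 1) = 1 :=
      Subtype.ext hw
    rw [h2] at h1
    simp [loop, h1]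

open Classical in
/-- The radial projection of the punctured disc to its bounding circle, extended by the identity
of `P`. The center of the disc goes to the point of angle `0`. -/
noncomputable def retract (he : IsSealing e P) (x : X) : P :=
  if hx : x ∈ P then ⟨x, hx⟩ else he.loop (direction ((Function.invFun e x : ClosedDisc) : ℂ))

theorem radius_apply (he : IsSealing e P) (w : ClosedDisc) : radius e P (e w) = ‖(w : ℂ)‖ := by
  by_cases hw : e w ∈ P
  · rw [radius_of_mem hw, (he.mem_iff w).1 hw]
  · rw [radius, if_neg hw, Function.leftInverse_invFun he.isEmbedding.injective]

theorem retract_of_mem (he : IsSealing e P) {x : X} (hx : x ∈ P) : he.retract x = ⟨x, hx⟩ :=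
  dif_pos hx

theorem retract_apply (he : IsSealing e P) (w : ClosedDisc) :
    he.retract (e w) = he.loop (direction w) := by
  by_cases h : e w ∈ P
  · rw [he.retract_of_mem h]
    have h1 := polar_direction_norm w
    have h2 : (⟨‖(w : ℂ)‖, norm_nonneg _, w.norm_le_one⟩ : Icc (0 : ℝ) 1) = 1 :=
      Subtype.ext ((he.mem_iff w).1 h)
    rw [h2] at h1
    simp [loop, h1]
  · rw [retract, dif_neg h, Function.leftInverse_invFun he.isEmbedding.injective]

/-- Continuity can be checked on the disc and on `P` separately. -/
theorem continuousAt [T2Space X] (he : IsSealing e P) {Y : Type*} [TopologicalSpace Y] {G : X → Y}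
    {x : X} (h₁ : ∀ w, e w = x → ContinuousAt (G ∘ e) w)
    (h₂ : ∀ p : P, (p : X) = x → ContinuousAt (fun p : P => G p) p) : ContinuousAt G x := by
  have hcov : range e ∪ P = univ := by
    refine eq_univ_of_forall fun x => ?_
    by_cases hx : x ∈ P
    · exact Or.inr hx
    · exact Or.inl (he.exists_of_notMem x hx)
  rw [← continuousWithinAt_univ, ← hcov]
  refine ContinuousWithinAt.union ?_ ?_
  · by_cases hx : x ∈ range e
    · obtain ⟨w, rfl⟩ := hx
      rw [ContinuousWithinAt, ← he.isEmbedding.isInducing.map_nhds_eq]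
      exact h₁ w rfl
    · refine continuousWithinAt_of_notMem_closure ?_
      rwa [(isCompact_range he.isEmbedding.continuous).isClosed.closure_eq]
  · by_cases hx : x ∈ P
    · have := h₂ ⟨x, hx⟩ rfl
      rwa [continuousWithinAt_iff_continuousAt_domRestrict G hx]
    · refine continuousWithinAt_of_notMem_closure ?_
      rwa [he.isClosed.closure_eq]

theorem continuous_radius [T2Space X] (he : IsSealing e P) : Continuous (radius e P) := by
  rw [continuous_iff_continuousAt]
  refine fun x => he.continuousAt (fun w _ => ?_) fun p _ => ?_
  · have : radius e P ∘ e = fun w : ClosedDisc => ‖(w : ℂ)‖ := funext he.radius_apply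
    rw [this]
    fun_prop
  · simp only [radius_of_mem (Subtype.prop _)]
    exact continuousAt_const

theorem continuousAt_retract [T2Space X] (he : IsSealing e P) {x : X} (hx : 0 < radius e P x) :
    ContinuousAt he.retract x := by
  refine he.continuousAt (fun w hw => ?_) fun p _ => ?_
  · rw [← hw, he.radius_apply, norm_pos_iff] at hx
    have h1 : ContinuousAt (fun w : ClosedDisc => he.loop (direction w)) w :=
      he.continuous_loop.continuousAt.comp
        ((continuousAt_direction hx).comp continuous_subtype_val.continuousAt)
    exact h1.congr (.of_forall fun w' => (he.retract_apply w').symm)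
  · have : (fun p : P => he.retract p) = id := funext fun p => he.retract_of_mem p.2
    rw [this]
    exact continuousAt_id

/-- Polar coordinates of the disc, as an open embedding into the sealed space. -/
def openPolar (e : ClosedDisc → X) (y : OpenCylinder) : X :=
  e (polar (y.1, inclusion Ioo_subset_Icc_self y.2))

theorem isOpenEmbedding_openPolar (he : IsSealing e P) : IsOpenEmbedding (openPolar e) := by
  refine ⟨he.isEmbedding.comp isOpenEmbedding_polar.isEmbedding, ?_⟩
  obtain ⟨W, hW, hWe⟩ := he.isEmbedding.isInducing.isOpen_iff.1 isOpenEmbedding_polar.isOpen_range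
  have : range (openPolar e) = W ∩ Pᶜ := by
    ext x
    constructor
    · rintro ⟨y, rfl⟩
      refine ⟨hWe.ge ⟨y, rfl⟩, fun h => ?_⟩
      have := (he.mem_iff _).1 h
      rw [norm_polar] at this
      exact y.2.2.2.ne this
    · rintro ⟨hx, hxP⟩
      obtain ⟨w, rfl⟩ := he.exists_of_notMem x hxP
      obtain ⟨y, hy⟩ := hWe.le hx
      exact ⟨y, congrArg e hy⟩
  rw [this]
  exact hW.inter he.isClosed.isOpen_compl

theorem isLindelof_preimage (he : IsSealing e P) {Z : Set X} (hZ : IsLindelof Z) :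
    IsLindelof (Subtype.val ⁻¹' Z : Set P) := by
  rw [IsInducing.subtypeVal.isLindelof_iff, Subtype.image_preimage_coe, inter_comm]
  exact hZ.inter_right he.isClosed

/-- The function that witnesses that a sealed longpipe does not almost stagnate: to a rigid
function it adds a dip at the center of the disc. -/
noncomputable def witness (e : ClosedDisc → X) (P : Set X) (x : X) : ℝ :=
  rigidFunction (openPolar e) x + min 0 (4 * radius e P x - 1)

theorem radius_openPolar (he : IsSealing e P) (y : OpenCylinder) :
    radius e P (openPolar e y) = y.2 := by
  rw [openPolar, he.radius_apply, norm_polar]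

/-- The rigid function and the dip have disjoint supports and opposite signs, so that they can be
recovered from their sum. -/
theorem max_min_witness (he : IsSealing e P) (x : X) :
    max (witness e P x) 0 = rigidFunction (openPolar e) x ∧
      min (witness e P x) 0 = min 0 (4 * radius e P x - 1) := by
  have hj := he.isOpenEmbedding_openPolar
  rcases (rigidFunction_nonneg hj x).eq_or_lt with h | h
  · rw [witness, ← h, zero_add]
    exact ⟨max_eq_right (min_le_left _ _), min_eq_left (min_le_left _ _)⟩
  · obtain ⟨y, rfl, hy⟩ := exists_of_rigidFunction_pos hj h
    have h1 : min 0 (4 * radius e P (openPolar e y) - 1) = 0 := by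
      rw [he.radius_openPolar]
      exact min_eq_left (by linarith)
    rw [witness, h1, add_zero]
    exact ⟨max_eq_left h.le, min_eq_right h.le⟩

/-- For a sealed longpipe, the rigid function lives in the sealing disc. -/
theorem not_almostStagnates [T2Space X] (he : IsSealing e P) (hP : IsLongpipe P)
    (hEC : EventuallyConstant X ℝ) : ¬ AlmostStagnates X ℝ := by
  intro hS
  have := hP.1
  have hj := he.isOpenEmbedding_openPolar
  obtain ⟨S, c, hc⟩ := hP.exists_isPipeAtlas
  have h0 : (0 : Ordinal.{0}) < ω₁ := Ordinal.omega_pos 1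
  have hc0 := hc.isOpenEmbedding 0 h0
  have hrad := he.continuous_radius
  have hwit : Continuous (witness e P) :=
    (continuous_rigidFunction hj).add (by fun_prop)
  obtain ⟨Z, hZ, r, hr⟩ := hS ⟨witness e P, hwit⟩
  replace hr : ∀ x, witness e P (r x) = witness e P x := hr
  have hrc : Continuous fun x => (r x : X) := continuous_subtype_val.comp r.continuous
  have hfix : ∀ z, (r (openPolar e (z, middle)) : X) = openPolar e (z, middle) :=
    apply_eq_of_rigidFunction_comp hj hrc fun x => by
      rw [← (he.max_min_witness (r x)).1, hr, (he.max_min_witness x).1]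
  -- The dip forces `r` to preserve the complement of the center of the disc.
  have hrpos : ∀ x, 0 < radius e P x → 0 < radius e P (r x) := by
    intro x hx
    refine lt_of_le_of_ne (radius_nonneg _) fun h => ?_
    have h1 := (he.max_min_witness (r x)).2
    rw [hr, (he.max_min_witness x).2, ← h] at h1
    have h2 : -1 < min 0 (4 * radius e P x - 1) := lt_min (by norm_num) (by linarith)
    rw [h1] at h2
    norm_num at h2
  obtain ⟨α, hα, hZα⟩ := hc.exists_subset_range
    ((he.isLindelof_preimage hZ).union (isCompact_range he.continuous_loop).isLindelof)
  have hcα := hc.isOpenEmbedding α hα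
  have hretr : ∀ x, he.retract (r x) ∈ range (c α) := by
    intro x
    apply hZα
    by_cases hx : (r x : X) ∈ P
    · rw [he.retract_of_mem hx]
      exact Or.inl (r x).2
    · rw [retract, dif_neg hx]
      exact Or.inr ⟨_, rfl⟩
  let ψ : X → Circle := fun x => angle (c α) (he.retract (r x))
  have hψ : ∀ x, 0 < radius e P x → ContinuousAt ψ x := fun x hx =>
    (continuousAt_angle hcα (hretr x)).comp (f := fun x => he.retract (r x))
      ((he.continuousAt_retract (hrpos x hx)).comp (f := fun x => (r x : X)) hrc.continuousAt)
  -- Cone off `ψ` over the disc, in order to apply the hypothesis on real-valued functions.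
  have hΦ : Continuous fun x => (radius e P x : ℂ) * ψ x := by
    rw [continuous_iff_continuousAt]
    intro x
    rcases (radius_nonneg (e := e) (P := P) x).eq_or_lt with h | h
    · rw [ContinuousAt, ← h, Complex.ofReal_zero, zero_mul]
      refine squeeze_zero_norm (a := radius e P) (fun y => ?_) ?_
      · exact (norm_ofReal_mul_circle (radius_nonneg y) _).le
      · have := hrad.tendsto x
        rwa [← h] at this
    · exact (Complex.continuous_ofReal.comp hrad).continuousAt.mul
        (isEmbedding_coe_circle.continuous.continuousAt.comp (hψ x h))
  obtain ⟨Z', hZ', hconst⟩ := hEC.complex hΦ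
  have hψP : Continuous fun p : P => ψ p := by
    rw [continuous_iff_continuousAt]
    exact fun p => (hψ p (by rw [radius_of_mem p.2]; exact one_pos)).comp
      continuous_subtype_val.continuousAt
  have hlog : HasLog fun y => ψ (c 0 y) := by
    refine hc.hasLog_of_eventually_const hP.2.1 hψP (he.isLindelof_preimage hZ')
      fun p hp q hq => Circle.ext ?_
    simpa [radius_of_mem p.2, radius_of_mem q.2] using hconst p hp q hq
  -- Both `loop` and the boundary of the first chart parametrize the boundary of `P`.
  have hmem : ∀ z, ∃ y, c 0 (y, bottom) = he.loop z := fun z =>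
    hc.exists_eq_of_mem_surfaceBoundary (he.range_loop.le ⟨z, rfl⟩)
  choose k hk using hmem
  have hkc : Continuous fun z => (k z, bottom) := by
    rw [hc0.isInducing.continuous_iff]
    exact he.continuous_loop.congr fun z => (hk z).symm
  have hmem' : ∀ z, ∃ y, he.loop y = c 0 (z, bottom) := fun z =>
    he.range_loop.ge ((hc.mem_surfaceBoundary_iff h0 _).2 rfl)
  choose l hl using hmem'
  have hlc : Continuous l := by
    rw [(he.continuous_loop.isClosedEmbedding he.injective_loop).isInducing.continuous_iff]
    exact (hc0.continuous.comp (by fun_prop : Continuous fun z : Circle => (z, bottom))).congr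
      fun z => (hl z).symm
  have hlog1 : HasLog fun z => ψ (he.loop z) := by
    simpa only [hk] using hlog.comp hkc
  -- Push the boundary circle into the disc, to the circle on which `r` is the identity.
  let half : Icc (1 / 2 : ℝ) 1 := ⟨1 / 2, by norm_num⟩
  let one : Icc (1 / 2 : ℝ) 1 := ⟨1, by norm_num⟩
  let ι : Icc (1 / 2 : ℝ) 1 → Icc (0 : ℝ) 1 := inclusion (Icc_subset_Icc_left (by norm_num))
  have hι : Continuous ι := continuous_inclusion _
  let A : Circle × Icc (1 / 2 : ℝ) 1 → X := fun y => e (polar (y.1, ι y.2))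
  have hA : Continuous A := he.isEmbedding.continuous.comp
    (continuous_polar.comp (continuous_fst.prodMk (hι.comp continuous_snd)))
  have hApos : ∀ y, 0 < radius e P (A y) := fun y => by
    rw [he.radius_apply, norm_polar]
    exact one_half_pos.trans_le y.2.2.1
  have hψA : Continuous fun y => ψ (A y) := by
    rw [continuous_iff_continuousAt]
    exact fun y => (hψ _ (hApos y)).comp hA.continuousAt
  have hAone : ∀ z, A (z, one) = he.loop z := fun z => rfl
  have hAhalf : ∀ z, A (z, half) = openPolar e (z, middle) := fun z => rfl
  have hψhalf : ∀ z, ψ (A (z, half)) = angle (c α) (he.loop z) := fun z => by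
    have h1 : direction (polar (z, ι half) : ℂ) = z :=
      direction_polar (y := (z, ι half)) one_half_pos
    have h2 : he.retract (A (z, half)) = he.loop z := by rw [he.retract_apply, h1]
    have h3 : (r (A (z, half)) : X) = A (z, half) := by rw [hAhalf, hfix]
    change angle (c α) (he.retract (r (A (z, half)))) = _
    rw [h3, h2]
  have hann : HasLog fun y => ψ (A y) :=
    HasLog.of_slice (convex_Icc _ _) hψA one (by simpa only [hAone] using hlog1)
  have hlog2 : HasLog fun z => angle (c α) (he.loop z) := by
    simpa only [hψhalf] using hann.comp (k := fun z : Circle => (z, half)) (by fun_prop)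
  exact hc.not_hasLog_angle hα (by simpa only [hl] using hlog2.comp hlc)

end IsSealing

theorem IsSealedLongpipe.exists_isSealing {X : Type*} [TopologicalSpace X]
    (hX : IsSealedLongpipe X) :
    ∃ (e : ClosedDisc → X) (P : Set X), IsSealing e P ∧ IsLongpipe P := by
  obtain ⟨-, e, he, P, rfl, hPc, hP, hcirc⟩ := hX
  refine ⟨e, _, ⟨he, hPc, fun w => ?_, fun x hx => ?_, hcirc⟩, hP⟩
  · have h1 : ‖(w : ℂ)‖ ≤ 1 := w.norm_le_one
    rw [mem_compl_iff, he.injective.mem_set_image, mem_ofPred_eq, not_lt]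
    exact ⟨h1.antisymm, ge_of_eq⟩
  · obtain ⟨w, -, hw⟩ := notMem_compl_iff.1 hx
    exact ⟨w, hw⟩

theorem theorem6p5 {X : Type*} [TopologicalSpace X]
    (hX : IsLongpipe X ∨ IsSealedLongpipe X) (hEC : EventuallyConstant X ℝ) :
    ¬ AlmostStagnates X ℝ := by
  rcases hX with hX | hX
  · exact hX.not_almostStagnates hEC
  · have := hX.1
    obtain ⟨e, P, he, hP⟩ := hX.exists_isSealing
    exact he.not_almostStagnates hP hEC
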